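/- For positive integers $n, m, \sigma$ with $\sigma \le n$ and $\eta \in [0,1]$, an instance of $\mathrm{LPN}^{\approx\sigma}_{\eta,n,m}$ is a pair $(A,\, b = As + e)$, where $s \in \mathbb{F}_2^n$ is uniform, $A \in \mathbb{F}_2^{m\times n}$ has independent $\mathrm{Ber}(\sigma/n)$ entries, $e \in \mathbb{F}_2^m$ has independent $\mathrm{Ber}(\eta)$ entries, and $s, A, e$ are independent. A (randomized) solver has success probability at least $\alpha$ if, on a random instance, it outputs $s$ with probability at least $\alpha$ over the instance and its own randomness. **Theorem.** There are a randomized oracle program $R$ and a constant $C$ such that the following holds. Let $m, n, k, \sigma$ be positive integers with $\sigma \le n$ and $m \ge 48\, n^3/\sigma^2$. Let $\varepsilon > 0$, $\delta > 6\cdot 2^{-(2n-1)}$, $\eta \in (0, 1/8)$, and suppose $$\frac{192}{\delta}\,\ln\!\left(\frac{8}{\varepsilon}\right) < k < 2^{2n-2}\,\varepsilon .$$ Given $n, m, k, \sigma, \lceil 1/\varepsilon\rceil, \lceil 1/\delta\rceil$, an instance with $m$ samples in dimension $n$, and access to any (randomized, stateless) oracle $\mathcal{O}$ that takes instances with $m$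 samples in dimension $kn$, the program $R$ always halts within $$C\, m\,\left(n + k + \tfrac1\delta + \tfrac1\varepsilon\right)^{C}$$ steps. If $\mathcal{O}$ has success probability at least $\varepsilon$ for $\mathrm{LPN}^{\approx k\sigma}_{\frac{1-(1-2\eta)^k}{2},\,kn,\,m}$, then $R^{\mathcal{O}}$ has success probability at least $1-\delta$ for $\mathrm{LPN}^{\approx\sigma}_{\eta,n,m}$. Here a program runs on a random access machine with addition, truncated subtraction and sign tests on natural numbers, which can also draw a uniform element of $\{0,\dots,r-1\}$ and a noise bit distributed as $\mathrm{Ber}(\eta)$. Each instruction costs one step, and an oracle query costs the total length of its question and answer. -/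

import Mathlib

namespace LPN

noncomputable section

/-! ### Distributions -/

/-- `Ber(p)` on `𝔽₂`: the bit `1` has probability `p`, the bit `0` has probability `1 - p`
(for `p ∈ [0, 1]`; other values of `p` are moved to the nearest point of `[0, 1]`). -/
def ber (p : ℝ) : PMF (ZMod 2) :=
  PMF.ofFintype
    (fun x => if x = 1 then min (ENNReal.ofReal p) 1 else 1 - min (ENNReal.ofReal p) 1) (by
      have h : (Finset.univ : Finset (ZMod 2)) = {0, 1} := by decide
      rw [h, Finset.sum_pair (by decide)]
      simp [tsub_add_cancel_of_le])

/-- The law of a vector of independent entries, all distributed as `μ`. -/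
def iid {α : Type} [Fintype α] (ι : Type) [Fintype ι] [DecidableEq ι] (μ : PMF α) :
    PMF (ι → α) :=
  PMF.ofFintype (fun x => ∏ i, μ (x i)) (by
    have h : ∑ a, μ a = 1 := by rw [← tsum_fintype (L := .unconditional _)]; exact μ.tsum_coe
    have h2 := (Finset.prod_univ_sum (fun _ : ι => (Finset.univ : Finset α))
      (fun _ a => μ a)).symm
    rw [Fintype.piFinset_univ] at h2
    rw [h2]
    simp [h])

/-- The law of `(s, A, A s + e)` for approximate-sparse LPN over `𝔽₂`: dimension `n`, `m` samples,
noise rate `η`, expected row weight `σ`. The secret `s` is uniform, the entries of `A` are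
independent `Ber(σ/n)`, the entries of `e` are independent `Ber(η)`. -/
def approxSparse (η : ℝ) (σ n m : ℕ) :
    PMF ((Fin n → ZMod 2) × Matrix (Fin m) (Fin n) (ZMod 2) × (Fin m → ZMod 2)) :=
  (PMF.uniformOfFintype (Fin n → ZMod 2)).bind fun s =>
  (iid (Fin m) (iid (Fin n) (ber ((σ : ℝ) / n)))).bind fun A =>
  (iid (Fin m) (ber η)).bind fun e =>
  PMF.pure (s, A, Matrix.mulVec A s + e)

/-- A (randomized) map from `m` samples `(A, b)` in dimension `n` to a candidate secret. -/
abbrev Solver (m n : ℕ) : Type :=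
  Matrix (Fin m) (Fin n) (ZMod 2) → (Fin m → ZMod 2) → PMF (Fin n → ZMod 2)

/-- The probability, over the instance and over the randomness of the solver, that the solver
outputs the secret of a random approximate-sparse LPN instance. -/
def successProb (η : ℝ) (σ n m : ℕ) (S : Solver m n) : ℝ :=
  (((approxSparse η σ n m).bind fun x =>
    (S x.2.1 x.2.2).map fun z => decide (z = x.1)) true).toReal

/-! ### Randomized oracle machines

A unit-cost random access machine (addition and truncated subtraction, no multiplication) with
registers and arrays of natural numbers, run by a structured program. Every loop has its number of
rounds fixed on entry. -/

/-- Programs. Registers `x, y, z, i, j` and arrays `a` are named by natural numbers. -/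
inductive Prog : Type
  /-- do nothing -/
  | skip : Prog
  /-- `x := c` -/
  | const (x c : ℕ) : Prog
  /-- `x := y + z` -/
  | add (x y z : ℕ) : Prog
  /-- `x := max (y - z) 0` -/
  | sub (x y z : ℕ) : Prog
  /-- `x := a[i, j]` -/
  | load (x a i j : ℕ) : Prog
  /-- `a[i, j] := x` -/
  | store (a i j x : ℕ) : Prog
  /-- `x :=` a uniformly random element of `{0, …, y - 1}` (and `0` if `y = 0`) -/
  | rand (x y : ℕ) : Prog
  /-- `x :=` a fresh noise bit, distributed as `Ber(η)` -/
  | noise (x : ℕ) : Prog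
  /-- submit the instance stored in arrays `3`, `4` to the oracle, receive its answer in
  array `5` -/
  | query : Prog
  /-- first `P`, then `Q` -/
  | seq (P Q : Prog) : Prog
  /-- if `x > 0` then `P` else `Q` -/
  | ite (x : ℕ) (P Q : Prog) : Prog
  /-- repeat `P`, as many times as the value of `x` on entry -/
  | loop (x : ℕ) (P : Prog) : Prog

/-- The memory of a machine, with a count of the steps made so far. -/
structure Store : Type where
  reg : ℕ → ℕ
  arr : ℕ → ℕ → ℕ → ℕ
  steps : ℕ

namespace Store

/-- Count `c` further steps. -/
def tick (c : ℕ) (s : Store) : Store := { s with steps := s.steps + c }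

/-- Write `v` to register `x`. -/
def setReg (x v : ℕ) (s : Store) : Store := { s with reg := Function.update s.reg x v }

/-- Write `v` to the cell `a[i, j]`. -/
def setCell (a i j v : ℕ) (s : Store) : Store :=
  { s with arr := Function.update s.arr a <|
      Function.update (s.arr a) i (Function.update (s.arr a i) j v) }

/-- Replace the whole array `a` by `M`. -/
def setArr (a : ℕ) (M : ℕ → ℕ → ℕ) (s : Store) : Store :=
  { s with arr := Function.update s.arr a M }

end Store

/-- A matrix over `𝔽₂` as an array of bits, `0` outside the range of the indices. -/
def encodeMat {m n : ℕ} (A : Matrix (Fin m) (Fin n) (ZMod 2)) : ℕ → ℕ → ℕ := fun i j =>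
  if h : i < m ∧ j < n then (A ⟨i, h.1⟩ ⟨j, h.2⟩).val else 0

/-- A vector over `𝔽₂` as row `0` of an array of bits. -/
def encodeVec {n : ℕ} (v : Fin n → ZMod 2) : ℕ → ℕ → ℕ := fun i j =>
  if h : i = 0 ∧ j < n then (v ⟨j, h.2⟩).val else 0

/-- The `m × n` matrix over `𝔽₂` stored in an array. -/
def decodeMat (m n : ℕ) (M : ℕ → ℕ → ℕ) : Matrix (Fin m) (Fin n) (ZMod 2) :=
  Matrix.of fun i j => (M i j : ZMod 2)

/-- The vector over `𝔽₂` of length `n` stored in row `0` of an array. -/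
def decodeVec (n : ℕ) (M : ℕ → ℕ → ℕ) : Fin n → ZMod 2 := fun j => (M 0 j : ZMod 2)

/-- The law of the final memory of a program started on a given memory, where the noise bits are
`Ber(η)` and the oracle `O` takes instances with `m` samples in dimension `d`. All random choices,
those of the oracle included, are independent. Each instruction costs one step, each test and each
round of a loop costs one step, and a query costs the length of the question and the answer. -/
def exec {m d : ℕ} (η : ℝ) (O : Solver m d) : Prog → Store → PMF Store
  | .skip => fun s => PMF.pure s
  | .const x c => fun s => PMF.pure ((s.setReg x c).tick 1)
  | .add x y z => fun s => PMF.pure ((s.setReg x (s.reg y + s.reg z)).tick 1)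
  | .sub x y z => fun s => PMF.pure ((s.setReg x (s.reg y - s.reg z)).tick 1)
  | .load x a i j => fun s => PMF.pure ((s.setReg x (s.arr a (s.reg i) (s.reg j))).tick 1)
  | .store a i j x => fun s => PMF.pure ((s.setCell a (s.reg i) (s.reg j) (s.reg x)).tick 1)
  | .rand x y => fun s =>
      (PMF.uniformOfFintype (Fin (s.reg y - 1 + 1))).map fun v => (s.setReg x v).tick 1
  | .noise x => fun s => (ber η).map fun v => (s.setReg x v.val).tick 1
  | .query => fun s =>
      (O (decodeMat m d (s.arr 3)) (decodeVec m (s.arr 4))).map fun z =>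
        (s.setArr 5 (encodeVec z)).tick (m * d + m + d)
  | .seq P Q => fun s => (exec η O P s).bind (exec η O Q)
  | .ite x P Q => fun s =>
      if 0 < s.reg x then exec η O P (s.tick 1) else exec η O Q (s.tick 1)
  | .loop x P => fun s =>
      (fun μ : PMF Store => μ.bind fun t => exec η O P (t.tick 1))^[s.reg x]
        (PMF.pure (s.tick 1))

/-- The initial memory: the parameters in registers `0, …, 5`, the instance `(A, b)` in arrays `0`
and `1`, everything else `0`. -/
def initStore {m n : ℕ} (k σ : ℕ) (ε δ : ℝ)
    (A : Matrix (Fin m) (Fin n) (ZMod 2)) (b : Fin m → ZMod 2) : Store where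
  reg := fun x =>
    match x with
    | 0 => n
    | 1 => m
    | 2 => k
    | 3 => σ
    | 4 => ⌈1 / ε⌉₊
    | 5 => ⌈1 / δ⌉₊
    | _ => 0
  arr := fun a =>
    match a with
    | 0 => encodeMat A
    | 1 => encodeVec b
    | _ => fun _ _ => 0
  steps := 0

/-- The law of the final memory when the program `R` runs on the instance `(A, b)`. -/
def Prog.run {m n d : ℕ} (R : Prog) (η : ℝ) (O : Solver m d) (k σ : ℕ) (ε δ : ℝ)
    (A : Matrix (Fin m) (Fin n) (ZMod 2)) (b : Fin m → ZMod 2) : PMF Store :=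
  exec η O R (initStore k σ ε δ A b)

/-- The solver that a program computes with the help of an oracle: its output is read from
array `2`. -/
def Prog.toSolver {m d : ℕ} (R : Prog) (η : ℝ) (O : Solver m d) (n k σ : ℕ) (ε δ : ℝ) :
    Solver m n :=
  fun A b => (R.run η O k σ ε δ A b).map fun s => decodeVec n (s.arr 2)

end

end LPN

namespace LPN

noncomputable section

/-! ### Products of finite laws -/

/-! Concatenating `k` independent small instances column by column and adding their right hand sides
gives exactly a large instance: the density `kσ / (kn)` is still `σ / n`, and the sum of `k`
independent `Ber(η)` bits has the noise rate of the oracle (`ber_sum`, `blockLaw_join`). So the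
oracle solves `k` independent small instances simultaneously with probability at least `ε`, and what
is needed is a direct product theorem: this forces a good solver for a single instance.

One round plants the given instance at a uniform position `j` among blocks with known secrets and
queries the oracle. Each wrong known block causes rejection with probability one half,
independently. Let `w` be the number of all wrong blocks, block `j` included. The answer is accepted
with probability `2^(-w)` if block `j` is right and `2 * 2^(-w)` if it is wrong. For a fixed given
instance, let `U` be the mean of `2^(-w)`, and let `W` be the mean of `2 * 2^(-w)` restricted to a
wrong block `j`, both over the position, the other blocks and the oracle. A round then yields the
right secret with probability `U - W/2`, a wrong one with probability `W`, and nothing otherwise.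
After `8 ⌈1/ε⌉ ⌈1/δ⌉` rounds the error is at most `δ/2 + W/U`, provided that `U ≥ ε/4` (`error_le`).

Two averages conclude (`direct_product`). Let `μ ≥ ε` be the mean of `2^(-w)` over random tuples.
Instances with `U ≤ μ/4` have probability at most `δ/4`: if their probability `h` were larger, all
but exponentially few tuples would contain at least `hk/2` of them, and they would carry more than
their share of `μ` (`prob_le_of_discounted`). Moreover, summing over `j` turns the indicator of a
wrong block `j` into the factor `w`, and `w * 2^(-w)` exceeds `L * 2^(-w)` by a negligible amount at
most; with `L = δk/64` the mean of `W` is at most `δμ/16`. The total error is at most `δ/4 + δ/2 +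
(4/μ)(δμ/16) = δ`.

The program is tied to this analysis by couplings (`Coupled`): each piece of code is coupled with
the random object it is meant to draw, so that only the relevant part of the memory has to be
described. `Keeps` takes care of everything a piece of code does not touch, and `Prog.cost` bounds
the steps by a recursion on the program. -/

theorem iid_apply {α ι : Type} [Fintype α] [Fintype ι] [DecidableEq ι] (μ : PMF α) (x : ι → α) :
    iid ι μ x = ∏ i, μ (x i) := rfl

theorem map_equiv_apply {α β : Type} (μ : PMF α) (e : α ≃ β) (b : β) :
    μ.map e b = μ (e.symm b) := by
  classical
  rw [PMF.map_apply, tsum_eq_single (e.symm b)]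
  · simp
  · intro a ha
    rw [if_neg]
    rintro rfl
    simp at ha

theorem bind_map_pair_apply {α β : Type} (μ : PMF α) (ν : PMF β) (x : α × β) :
    (μ.bind fun a => ν.map (Prod.mk a)) x = μ x.1 * ν x.2 := by
  classical
  rw [PMF.bind_apply, tsum_eq_single x.1]
  · rw [PMF.map_apply, tsum_eq_single x.2]
    · simp
    · intro b hb
      rw [if_neg]
      intro h
      exact hb (by rw [h])
  · intro a ha
    rw [PMF.map_apply]
    convert mul_zero _
    rw [ENNReal.tsum_eq_zero]
    intro b
    rw [if_neg]
    intro h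
    exact ha (by rw [h])

/-- This is the recursion followed by a loop that appends one fresh sample in each round. -/
theorem iid_succ {α : Type} [Fintype α] (r : ℕ) (μ : PMF α) :
    iid (Fin (r + 1)) μ
      = (iid (Fin r) μ).bind fun f => μ.map (Fin.snoc (α := fun _ => α) f) := by
  classical
  ext x
  rw [PMF.bind_apply, tsum_eq_single (Fin.init x)]
  · rw [PMF.map_apply, tsum_eq_single (x (Fin.last r))]
    · rw [iid_apply, iid_apply, Fin.prod_univ_castSucc]
      simp [Fin.init]
    · intro a ha
      rw [if_neg]
      intro h
      apply ha
      rw [h]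
      simp
  · intro f hf
    rw [PMF.map_apply]
    convert mul_zero _
    rw [ENNReal.tsum_eq_zero]
    intro a
    rw [if_neg]
    rintro rfl
    simp at hf

theorem iid_reindex {α ι κ : Type} [Fintype α] [Fintype ι] [DecidableEq ι] [Fintype κ]
    [DecidableEq κ] (μ : PMF α) (e : ι ≃ κ) :
    (iid ι μ).map (fun f => f ∘ e.symm) = iid κ μ := by
  ext x
  have := map_equiv_apply (iid ι μ) (e.arrowCongr (Equiv.refl α)) x
  have h2 : (⇑(e.arrowCongr (Equiv.refl α))) = (fun f : ι → α => f ∘ e.symm) := by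
    ext f; simp
  rw [h2] at this
  rw [this, iid_apply, iid_apply]
  rw [← e.prod_comp]
  simp

theorem iid_curry {α ι κ : Type} [Fintype α] [Fintype ι] [DecidableEq ι] [Fintype κ]
    [DecidableEq κ] (μ : PMF α) :
    (iid ι (iid κ μ)).map (fun f (p : ι × κ) => f p.1 p.2) = iid (ι × κ) μ := by
  ext x
  have := map_equiv_apply (iid ι (iid κ μ)) (Equiv.curry ι κ α).symm x
  have h2 : (⇑(Equiv.curry ι κ α).symm) = (fun (f : ι → κ → α) (p : ι × κ) => f p.1 p.2) := by
    ext f p; simp [Function.uncurry]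
  rw [h2] at this
  rw [this, iid_apply, iid_apply, Fintype.prod_prod_type]
  simp [iid_apply, Function.curry]

theorem iid_swap {α ι κ : Type} [Fintype α] [Fintype ι] [DecidableEq ι] [Fintype κ]
    [DecidableEq κ] (μ : PMF α) :
    (iid ι (iid κ μ)).map (fun f c r => f r c) = iid κ (iid ι μ) := by
  ext x
  have := map_equiv_apply (iid ι (iid κ μ)) (Equiv.piComm fun _ _ => α) x
  have h2 : (⇑(Equiv.piComm fun (_ : ι) (_ : κ) => α)) = (fun f c r => f r c) := by
    ext f p; simp [Function.swap]
  rw [h2] at this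
  rw [this, iid_apply, iid_apply]
  simp only [iid_apply]
  rw [Finset.prod_comm]
  simp [Function.swap]

theorem iid_pair {α β ι : Type} [Fintype α] [Fintype β] [Fintype ι] [DecidableEq ι]
    (μ : PMF α) (ν : PMF β) :
    ((iid ι μ).bind fun f => (iid ι ν).map fun g i => (f i, g i))
      = iid ι (μ.bind fun a => ν.map (Prod.mk a)) := by
  ext x
  have := map_equiv_apply ((iid ι μ).bind fun f => (iid ι ν).map (Prod.mk f))
    (Equiv.arrowProdEquivProdArrow ι (fun _ => α) (fun _ => β)).symm x
  rw [PMF.map_bind] at this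
  simp only [PMF.map_comp] at this
  refine Eq.trans ?_ (this.trans ?_)
  · rfl
  · rw [bind_map_pair_apply, iid_apply, iid_apply, iid_apply, ← Finset.prod_mul_distrib]
    simp only [bind_map_pair_apply]
    rfl

/-- Each factor on the right is a sum over a fibre of `f`; expanding the product gives one term for
each vector of preimages. -/
theorem iid_map {α β ι : Type} [Fintype α] [Fintype β] [Fintype ι] [DecidableEq ι]
    (μ : PMF α) (f : α → β) :
    (iid ι μ).map (fun g i => f (g i)) = iid ι (μ.map f) := by
  classical
  ext x
  rw [PMF.map_apply, tsum_fintype, iid_apply]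
  have h : ∀ b, (μ.map f) b = ∑ a, if b = f a then μ a else 0 := by
    intro b; rw [PMF.map_apply, tsum_fintype]
  simp only [h]
  rw [Finset.prod_univ_sum, Fintype.piFinset_univ]
  refine Finset.sum_congr rfl fun g _ => ?_
  rw [iid_apply]
  by_cases hx : x = fun i => f (g i)
  · simp [hx]
  · rw [if_neg hx]
    symm
    have : ∃ i, x i ≠ f (g i) := by
      by_contra hc
      push Not at hc
      exact hx (funext hc)
    obtain ⟨i, hi⟩ := this
    exact Finset.prod_eq_zero (Finset.mem_univ i) (if_neg hi)

theorem uniform_pi_eq_iid {α ι : Type} [Fintype α] [Nonempty α] [Fintype ι] [DecidableEq ι] :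
    PMF.uniformOfFintype (ι → α) = iid ι (PMF.uniformOfFintype α) := by
  ext x
  simp [iid_apply, ENNReal.inv_pow]

/-! ### Bernoulli laws -/

theorem ber_one {p : ℝ} (h1 : p ≤ 1) : ber p 1 = ENNReal.ofReal p := by
  have : ENNReal.ofReal p ≤ 1 := by simpa using h1
  simp [ber, PMF.ofFintype_apply, this]

theorem ber_zero {p : ℝ} (h0 : 0 ≤ p) (h1 : p ≤ 1) : ber p 0 = ENNReal.ofReal (1 - p) := by
  have : ENNReal.ofReal p ≤ 1 := by simpa using h1
  rw [ENNReal.ofReal_sub _ h0]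
  simp [ber, PMF.ofFintype_apply, this]

theorem pmf_zmod_two_ext {μ ν : PMF (ZMod 2)} (h : μ 1 = ν 1) : μ = ν := by
  have e : ∀ ρ : PMF (ZMod 2), ρ 0 + ρ 1 = 1 := by
    intro ρ
    have h := ρ.tsum_coe
    rw [tsum_fintype] at h
    have h' : (Finset.univ : Finset (ZMod 2)) = {0, 1} := by decide
    rwa [h', Finset.sum_pair (by decide)] at h
  have h0 : μ 0 = ν 0 := by
    have h1 := (e μ).trans (e ν).symm
    rw [h] at h1
    exact (ENNReal.add_left_inj (PMF.apply_ne_top ν 1)).1 h1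
  ext x
  fin_cases x
  · exact h0
  · exact h

theorem ber_convolution {p q : ℝ} (hp0 : 0 ≤ p) (hp1 : p ≤ 1) (hq0 : 0 ≤ q) (hq1 : q ≤ 1) :
    ((ber p).bind fun a => (ber q).map fun b => a + b) = ber (p + q - 2 * p * q) := by
  apply pmf_zmod_two_ext
  have h' : (Finset.univ : Finset (ZMod 2)) = {0, 1} := by decide
  rw [PMF.bind_apply, tsum_fintype, h', Finset.sum_pair (by decide)]
  rw [PMF.map_apply, PMF.map_apply, tsum_fintype, tsum_fintype, h', Finset.sum_pair (by decide),
    Finset.sum_pair (by decide)]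
  have e : (1 : ZMod 2) = 1 + 1 ↔ False := by decide
  have e' : (1 : ZMod 2) = 0 ↔ False := by decide
  simp only [e, e', if_true, if_false, add_zero, zero_add]
  rw [ber_one hp1, ber_one hq1, ber_zero hp0 hp1, ber_zero hq0 hq1, ber_one (by nlinarith),
    ← ENNReal.ofReal_mul (by linarith), ← ENNReal.ofReal_mul hp0, ← ENNReal.ofReal_add
      (by apply mul_nonneg <;> linarith) (by apply mul_nonneg <;> linarith)]
  congr 1
  ring

/-- The bias `1 - 2p` is multiplicative under addition of independent bits. For `p ≤ 1/2` its powers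
stay in `[0, 1]`. -/
theorem ber_sum {p : ℝ} (hp0 : 0 ≤ p) (hp1 : p ≤ 1 / 2) (k : ℕ) :
    (iid (Fin k) (ber p)).map (fun f => ∑ c, f c) = ber ((1 - (1 - 2 * p) ^ k) / 2) := by
  induction k with
  | zero =>
    apply pmf_zmod_two_ext
    simp only [Finset.univ_eq_empty, Finset.sum_empty, pow_zero, sub_self, zero_div]
    rw [ber_one zero_le_one]
    erw [PMF.map_const]
    simp
  | succ k ih =>
    have h0 : 0 ≤ (1 - 2 * p) ^ k := pow_nonneg (by linarith) k
    have h1 : (1 - 2 * p) ^ k ≤ 1 := pow_le_one₀ (by linarith) (by linarith)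
    rw [iid_succ, PMF.map_bind]
    simp only [PMF.map_comp]
    have e : ∀ f : Fin k → ZMod 2, ((fun f : Fin (k + 1) → ZMod 2 => ∑ c, f c) ∘
        Fin.snoc (α := fun _ => ZMod 2) f) = fun b => (∑ c, f c) + b := by
      intro f
      ext b
      simp [Fin.sum_univ_castSucc]
    simp only [e]
    have := ber_convolution (p := (1 - (1 - 2 * p) ^ k) / 2) (q := p) (by linarith) (by linarith)
      hp0 (by linarith)
    rw [← ih, PMF.bind_map] at this
    refine Eq.trans ?_ (this.trans ?_)
    · rfl
    · congr 1
      ring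

/-- The machine draws uniform numbers only; this is how it obtains a matrix entry. -/
theorem uniform_threshold_eq_ber {n σ : ℕ} (hn : 0 < n) (hσ : σ ≤ n) [Nonempty (Fin n)] :
    ((PMF.uniformOfFintype (Fin n)).map fun v : Fin n => if (v : ℕ) < σ then (1 : ZMod 2) else 0)
      = ber ((σ : ℝ) / n) := by
  classical
  have hn' : (0 : ℝ) < n := by exact_mod_cast hn
  apply pmf_zmod_two_ext
  rw [ber_one (by rw [div_le_one hn']; exact_mod_cast hσ), PMF.map_apply, tsum_fintype]
  have : ∀ v ∈ (Finset.univ : Finset (Fin n)),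
      (if (1 : ZMod 2) = (if (v : ℕ) < σ then (1 : ZMod 2) else 0) then
      PMF.uniformOfFintype (Fin n) v else 0) = if (v : ℕ) < σ then (n : ENNReal)⁻¹ else 0 := by
    intro v _
    by_cases h : (v : ℕ) < σ <;> simp [h]
  refine Eq.trans ?_ ((Finset.sum_congr rfl this).trans ?_)
  · refine Finset.sum_congr rfl fun v _ => ?_
    congr 1
  rw [← Finset.sum_filter, Finset.sum_const]
  have hc : (Finset.univ.filter fun v : Fin n => (v : ℕ) < σ).card = σ := by
    rw [Fin.card_filter_val_lt]; omega
  rw [hc, ENNReal.ofReal_div_of_pos hn']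
  simp [div_eq_mul_inv]

/-! ### Couplings -/

/-- Some coupling of `μ` and `ν` is supported on the relation `Φ`. -/
def Coupled {α β : Type} (ν : PMF β) (μ : PMF α) (Φ : α → β → Prop) : Prop :=
  ∃ π : PMF (α × β), π.map Prod.fst = μ ∧ π.map Prod.snd = ν ∧ ∀ p ∈ π.support, Φ p.1 p.2

theorem bind_congr_support {α β : Type} (μ : PMF α) {f g : α → PMF β}
    (h : ∀ a ∈ μ.support, f a = g a) : μ.bind f = μ.bind g := by
  ext b
  simp only [PMF.bind_apply]
  congr 1
  ext a
  by_cases ha : a ∈ μ.support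
  · rw [h a ha]
  · rw [PMF.apply_eq_zero_iff μ a |>.2 ha, zero_mul, zero_mul]

namespace Coupled

variable {α β γ ι : Type}

/-- Couplings of consecutive steps can be glued: after drawing a related pair, continue with a
coupling chosen for that pair. -/
theorem bind {ν : PMF β} {μ : PMF α} {Φ : α → β → Prop} (h : Coupled ν μ Φ)
    {E : β → PMF γ} {K : α → PMF ι} {Ψ : ι → γ → Prop}
    (hE : ∀ a b, Φ a b → Coupled (E b) (K a) Ψ) : Coupled (ν.bind E) (μ.bind K) Ψ := by
  classical
  obtain ⟨π, rfl, rfl, hπ⟩ := h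
  -- Unrelated pairs have probability zero under `π`; the independent coupling is only a default
  -- there.
  let ρ : α × β → PMF (ι × γ) := fun p =>
    if hp : Φ p.1 p.2 then (hE p.1 p.2 hp).choose else
      (K p.1).bind fun i => (E p.2).map (Prod.mk i)
  have hρ : ∀ p ∈ π.support, (ρ p).map Prod.fst = K p.1 ∧ (ρ p).map Prod.snd = E p.2 ∧
      ∀ q ∈ (ρ p).support, Ψ q.1 q.2 := by
    intro p hp
    have := (hE p.1 p.2 (hπ p hp)).choose_spec
    simpa only [ρ, dif_pos (hπ p hp)] using this
  refine ⟨π.bind ρ, ?_, ?_, ?_⟩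
  · rw [PMF.map_bind, PMF.bind_map]
    exact bind_congr_support _ fun p hp => (hρ p hp).1
  · rw [PMF.map_bind, PMF.bind_map]
    exact bind_congr_support _ fun p hp => (hρ p hp).2.1
  · intro q hq
    rw [PMF.mem_support_bind_iff] at hq
    obtain ⟨p, hp, hq⟩ := hq
    exact (hρ p hp).2.2 q hq

theorem pure {a : α} {b : β} {Φ : α → β → Prop} (h : Φ a b) :
    Coupled (PMF.pure b) (PMF.pure a) Φ := by
  refine ⟨PMF.pure (a, b), by simp [PMF.pure_map], by simp [PMF.pure_map], ?_⟩
  intro p hp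
  rw [PMF.mem_support_pure_iff] at hp
  subst hp
  exact h

theorem of_map {ν : PMF β} {f : β → γ} {g : β → α} {Φ : α → γ → Prop} (h : ∀ b, Φ (g b) (f b)) :
    Coupled (ν.map f) (ν.map g) Φ := by
  refine ⟨ν.map fun b => (g b, f b), by rw [PMF.map_comp]; rfl, by rw [PMF.map_comp]; rfl, ?_⟩
  intro p hp
  rw [PMF.mem_support_map_iff] at hp
  obtain ⟨b, -, rfl⟩ := hp
  exact h b

theorem mono {ν : PMF β} {μ : PMF α} {Φ Ψ : α → β → Prop} (h : Coupled ν μ Φ)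
    (hΨ : ∀ a b, a ∈ μ.support → b ∈ ν.support → Φ a b → Ψ a b) : Coupled ν μ Ψ := by
  obtain ⟨π, rfl, rfl, hπ⟩ := h
  refine ⟨π, rfl, rfl, fun p hp => hΨ _ _ ?_ ?_ (hπ p hp)⟩
  · rw [PMF.mem_support_map_iff]; exact ⟨p, hp, rfl⟩
  · rw [PMF.mem_support_map_iff]; exact ⟨p, hp, rfl⟩

theorem map_right {ν : PMF β} {μ : PMF α} {Φ : α → β → Prop} (h : Coupled ν μ Φ) {f : α → γ}
    {Ψ : γ → β → Prop} (hΨ : ∀ a b, Φ a b → Ψ (f a) b) : Coupled ν (μ.map f) Ψ := by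
  obtain ⟨π, rfl, rfl, hπ⟩ := h
  refine ⟨π.map fun p => (f p.1, p.2), by simp only [PMF.map_comp]; rfl,
    by simp only [PMF.map_comp]; rfl, ?_⟩
  intro p hp
  rw [PMF.mem_support_map_iff] at hp
  obtain ⟨b, hb, rfl⟩ := hp
  exact hΨ _ _ (hπ b hb)

theorem of_forall {ν : PMF β} {a : α} {Φ : α → β → Prop} (h : ∀ b ∈ ν.support, Φ a b) :
    Coupled ν (PMF.pure a) Φ := by
  refine ⟨ν.map (Prod.mk a), ?_, ?_, ?_⟩
  · rw [PMF.map_comp]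
    exact PMF.map_const ν a
  · rw [PMF.map_comp]
    exact PMF.map_id ν
  · intro p hp
    rw [PMF.mem_support_map_iff] at hp
    obtain ⟨b, hb, rfl⟩ := hp
    exact h b hb

/-- This is how a coupling is finally used: a quantity determined in the same way on both sides has
the same law. -/
theorem map_eq {ν : PMF β} {μ : PMF α} {Φ : α → β → Prop} (h : Coupled ν μ Φ) {f : α → γ}
    {g : β → γ} (hfg : ∀ a b, Φ a b → g b = f a) : ν.map g = μ.map f := by
  obtain ⟨π, rfl, rfl, hπ⟩ := h
  rw [PMF.map_comp, PMF.map_comp]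
  simp only [PMF.map]
  refine bind_congr_support _ fun p hp => ?_
  simp [hfg _ _ (hπ p hp)]

/-- A step that leaves the abstract value unchanged, carried out first. -/
theorem det_bind {ν : PMF β} {Φ : β → Prop} (h : ∀ b ∈ ν.support, Φ b)
    {E : β → PMF γ} {μ : PMF ι} {Ψ : ι → γ → Prop}
    (hE : ∀ b, Φ b → Coupled (E b) μ Ψ) : Coupled (ν.bind E) μ Ψ := by
  have := (of_forall (a := ()) (Φ := fun _ => Φ) h).bind (E := E) (K := fun _ => μ) (Ψ := Ψ)
    fun _ b hb => hE b hb
  rwa [PMF.pure_bind] at this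

/-- A step that leaves the abstract value unchanged, carried out last. -/
theorem bind_det {ν : PMF β} {μ : PMF α} {Φ : α → β → Prop} (h : Coupled ν μ Φ)
    {E : β → PMF γ} {Ψ : α → γ → Prop}
    (hE : ∀ a b, Φ a b → ∀ c ∈ (E b).support, Ψ a c) : Coupled (ν.bind E) μ Ψ := by
  have := h.bind (E := E) (K := PMF.pure) (Ψ := Ψ) fun a b hb => of_forall (hE a b hb)
  rwa [PMF.bind_pure] at this

end Coupled

/-! ### Iterated kernels -/

/-- The law after `r` steps of a time-dependent chain started at `a`. -/
def chain {X : ℕ → Type} (K : ∀ r, X r → PMF (X (r + 1))) (a : X 0) : ∀ r, PMF (X r)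
  | 0 => PMF.pure a
  | r + 1 => (chain K a r).bind (K r)

theorem chain_snoc {α : Type} [Fintype α] (μ : PMF α) (N : ℕ) :
    chain (X := fun r => Fin r → α) (fun _ f => μ.map (Fin.snoc (α := fun _ => α) f))
      Fin.elim0 N = iid (Fin N) μ := by
  induction N with
  | zero =>
    ext x
    have : x = Fin.elim0 := Subsingleton.elim _ _
    subst this
    simp [chain, iid_apply]
  | succ N ih => rw [chain, ih, iid_succ]

theorem chain_const_eq_iterate {α : Type} (K : α → PMF α) (a : α) (N : ℕ) :
    chain (X := fun _ => α) (fun _ => K) a N = (fun μ : PMF α => μ.bind K)^[N] (PMF.pure a) := by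
  induction N with
  | zero => rfl
  | succ N ih => rw [chain, ih, Function.iterate_succ_apply']

/-! ### Frame and cost of programs -/

namespace Prog

/-- The registers that a program may write to. -/
def regs : Prog → List ℕ
  | .skip => []
  | .const x _ => [x]
  | .add x _ _ => [x]
  | .sub x _ _ => [x]
  | .load x _ _ _ => [x]
  | .store _ _ _ _ => []
  | .rand x _ => [x]
  | .noise x => [x]
  | .query => []
  | .seq P Q => P.regs ++ Q.regs
  | .ite _ P Q => P.regs ++ Q.regs
  | .loop _ P => P.regs

/-- The arrays that a program may write to. -/
def arrs : Prog → List ℕ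
  | .store a _ _ _ => [a]
  | .query => [5]
  | .seq P Q => P.arrs ++ Q.arrs
  | .ite _ P Q => P.arrs ++ Q.arrs
  | .loop _ P => P.arrs
  | _ => []

/-- The registers that hold the number of rounds of a loop. -/
def counters : Prog → List ℕ
  | .seq P Q => P.counters ++ Q.counters
  | .ite _ P Q => P.counters ++ Q.counters
  | .loop x P => x :: P.counters
  | _ => []

/-- A bound for the number of steps, when a query costs `q` and the loop counters have the
values `ρ`. -/
def cost (q : ℕ) (ρ : ℕ → ℕ) : Prog → ℕ
  | .skip => 0
  | .query => q
  | .seq P Q => P.cost q ρ + Q.cost q ρ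
  | .ite _ P Q => 1 + P.cost q ρ + Q.cost q ρ
  | .loop x P => 1 + ρ x * (1 + P.cost q ρ)
  | _ => 1

end Prog

/-- Two memories agree outside of what the program may write to. -/
structure Keeps (P : Prog) (s t : Store) : Prop where
  reg : ∀ x, x ∉ P.regs → t.reg x = s.reg x
  arr : ∀ a, a ∉ P.arrs → t.arr a = s.arr a

section exec

variable {m d : ℕ} {η : ℝ} {O : Solver m d}

theorem exec_loop_eq_chain (x : ℕ) (P : Prog) (s : Store) :
    exec η O (.loop x P) s
      = chain (X := fun _ => Store) (fun _ t => exec η O P (t.tick 1)) (s.tick 1) (s.reg x) := by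
  rw [chain_const_eq_iterate]
  rfl

/-- A relation that holds throughout a chain. -/
theorem forall_support_chain {X : ℕ → Type} {K : ∀ r, X r → PMF (X (r + 1))} {a : X 0}
    {Φ : ∀ r, X r → Prop} (N : ℕ) (h0 : Φ 0 a)
    (hs : ∀ r, r < N → ∀ t, Φ r t → ∀ t' ∈ (K r t).support, Φ (r + 1) t') :
    ∀ t ∈ (chain K a N).support, Φ N t := by
  induction N with
  | zero =>
    intro t ht
    rw [chain, PMF.mem_support_pure_iff] at ht
    exact ht ▸ h0
  | succ N ih =>
    intro t ht
    rw [chain, PMF.mem_support_bind_iff] at ht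
    obtain ⟨u, hu, ht⟩ := ht
    exact hs N (Nat.lt_succ_self N) u
      (ih (fun r hr => hs r (Nat.lt_succ_of_lt hr)) u hu) t ht

theorem keeps_of_mem_support (P : Prog) :
    ∀ s, ∀ t ∈ (exec η O P s).support, Keeps P s t := by
  induction P with
  | skip =>
    intro s t ht
    rw [exec, PMF.mem_support_pure_iff] at ht
    subst ht
    exact ⟨fun _ _ => rfl, fun _ _ => rfl⟩
  | const x c | add x y z | sub x y z | load x a i j =>
    intro s t ht
    rw [exec, PMF.mem_support_pure_iff] at ht
    subst ht
    refine ⟨fun w hw => ?_, fun _ _ => rfl⟩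
    simp only [Prog.regs, List.mem_singleton] at hw
    simp [Store.tick, Store.setReg, hw]
  | store a i j x =>
    intro s t ht
    rw [exec, PMF.mem_support_pure_iff] at ht
    subst ht
    refine ⟨fun _ _ => rfl, fun w hw => ?_⟩
    simp only [Prog.arrs, List.mem_singleton] at hw
    simp [Store.tick, Store.setCell, hw]
  | rand x y | noise x =>
    intro s t ht
    rw [exec, PMF.mem_support_map_iff] at ht
    obtain ⟨v, -, rfl⟩ := ht
    refine ⟨fun w hw => ?_, fun _ _ => rfl⟩
    simp only [Prog.regs, List.mem_singleton] at hw
    simp [Store.tick, Store.setReg, hw]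
  | query =>
    intro s t ht
    rw [exec, PMF.mem_support_map_iff] at ht
    obtain ⟨v, -, rfl⟩ := ht
    refine ⟨fun _ _ => rfl, fun w hw => ?_⟩
    simp only [Prog.arrs, List.mem_singleton] at hw
    simp [Store.tick, Store.setArr, hw]
  | seq P Q ihP ihQ =>
    intro s t ht
    rw [exec, PMF.mem_support_bind_iff] at ht
    obtain ⟨u, hu, ht⟩ := ht
    have h1 := ihP s u hu
    have h2 := ihQ u t ht
    constructor
    · intro w hw
      simp only [Prog.regs, List.mem_append, not_or] at hw
      rw [h2.reg w hw.2, h1.reg w hw.1]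
    · intro w hw
      simp only [Prog.arrs, List.mem_append, not_or] at hw
      rw [h2.arr w hw.2, h1.arr w hw.1]
  | ite x P Q ihP ihQ =>
    intro s t ht
    rw [exec] at ht
    beta_reduce at ht
    constructor
    · intro w hw
      simp only [Prog.regs, List.mem_append, not_or] at hw
      split_ifs at ht
      · exact (ihP _ t ht).reg w hw.1
      · exact (ihQ _ t ht).reg w hw.2
    · intro w hw
      simp only [Prog.arrs, List.mem_append, not_or] at hw
      split_ifs at ht
      · exact (ihP _ t ht).arr w hw.1
      · exact (ihQ _ t ht).arr w hw.2
  | loop x P ih =>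
    intro s
    rw [exec_loop_eq_chain]
    refine forall_support_chain (X := fun _ => Store) (Φ := fun _ t => Keeps (.loop x P) s t) _
      ⟨fun _ _ => rfl, fun _ _ => rfl⟩ ?_
    intro r _ t ht t' ht'
    have h := ih _ t' ht'
    exact ⟨fun w hw => (h.reg w hw).trans (ht.reg w hw),
      fun w hw => (h.arr w hw).trans (ht.arr w hw)⟩

/-- Since loop counters are never written to, the values `ρ` remain valid at every entry of a loop,
however deeply nested, and the bound is deterministic. -/
theorem steps_le_of_mem_support (ρ : ℕ → ℕ) (P : Prog) (hP : ∀ x ∈ P.counters, x ∉ P.regs) :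
    ∀ s, (∀ x ∈ P.counters, s.reg x = ρ x) → ∀ t ∈ (exec η O P s).support,
      t.steps ≤ s.steps + P.cost (m * d + m + d) ρ := by
  induction P with
  | skip =>
    intro s _ t ht
    rw [exec, PMF.mem_support_pure_iff] at ht
    subst ht
    exact le_rfl
  | const x c | add x y z | sub x y z | load x a i j | store a i j x =>
    intro s _ t ht
    rw [exec, PMF.mem_support_pure_iff] at ht
    subst ht
    exact le_rfl
  | rand x y | noise x | query =>
    intro s _ t ht
    rw [exec, PMF.mem_support_map_iff] at ht
    obtain ⟨v, -, rfl⟩ := ht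
    exact le_rfl
  | seq P Q ihP ihQ =>
    intro s hs t ht
    simp only [Prog.counters, Prog.regs, List.mem_append, not_or] at hP hs
    rw [exec, PMF.mem_support_bind_iff] at ht
    obtain ⟨u, hu, ht⟩ := ht
    have h1 := ihP (fun x hx => (hP x (.inl hx)).1) s (fun x hx => hs x (.inl hx)) u hu
    have h2 := ihQ (fun x hx => (hP x (.inr hx)).2) u (fun x hx => by
      rw [(keeps_of_mem_support P s u hu).reg x (hP x (.inr hx)).1, hs x (.inr hx)]) t ht
    simp only [Prog.cost]
    omega
  | ite x P Q ihP ihQ =>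
    intro s hs t ht
    simp only [Prog.counters, Prog.regs, List.mem_append, not_or] at hP hs
    rw [exec] at ht
    beta_reduce at ht
    simp only [Prog.cost]
    split_ifs at ht
    · have := ihP (fun x hx => (hP x (.inl hx)).1) (s.tick 1) (fun x hx => hs x (.inl hx)) t ht
      simp only [Store.tick] at this
      omega
    · have := ihQ (fun x hx => (hP x (.inr hx)).2) (s.tick 1) (fun x hx => hs x (.inr hx)) t ht
      simp only [Store.tick] at this
      omega
  | loop x P ih =>
    intro s hs t ht
    simp only [Prog.counters, Prog.regs, List.mem_cons] at hP hs
    rw [exec_loop_eq_chain] at ht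
    have key := forall_support_chain (X := fun _ => Store)
      (Φ := fun r t => t.steps ≤ s.steps + 1 + r * (1 + P.cost (m * d + m + d) ρ) ∧
        ∀ y ∈ P.counters, t.reg y = ρ y) (K := fun _ t => exec η O P (t.tick 1))
      (a := s.tick 1) (s.reg x) ⟨by simp [Store.tick], fun y hy => hs y (.inr hy)⟩ ?_ t ht
    · simp only [Prog.cost]
      rw [← hs x (.inl rfl)]
      omega
    · rintro r - u ⟨hu, hu'⟩ v hv
      have h1 := ih (fun y hy => hP y (.inr hy)) (u.tick 1) hu' v hv
      refine ⟨?_, fun y hy => ?_⟩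
      · simp only [Store.tick] at h1
        rw [Nat.succ_mul]
        omega
      · rw [(keeps_of_mem_support P _ v hv).reg y (hP y (.inr hy))]
        exact hu' y hy

/-! ### Rules for programs -/

/-- The rule of invariants for loops. `Keeps P s t` is carried along automatically, so that an
invariant need not mention registers and arrays that the body leaves alone. -/
theorem coupled_loop {X : ℕ → Type} {K : ∀ r, X r → PMF (X (r + 1))} {a₀ : X 0}
    (Φ : ∀ r, X r → Store → Prop) {x N : ℕ} {P : Prog} {s : Store} (hN : s.reg x = N)
    (h0 : Φ 0 a₀ (s.tick 1))
    (hs : ∀ r, r < N → ∀ a t, Φ r a t → Keeps P s t →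
      Coupled (exec η O P (t.tick 1)) (K r a) (Φ (r + 1))) :
    Coupled (exec η O (.loop x P) s) (chain K a₀ N) (Φ N) := by
  rw [exec_loop_eq_chain, hN]
  have key : ∀ r, r ≤ N → Coupled (chain (X := fun _ => Store)
      (fun _ t => exec η O P (t.tick 1)) (s.tick 1) r) (chain K a₀ r)
      (fun a t => Φ r a t ∧ Keeps P s t) := by
    intro r
    induction r with
    | zero =>
      intro _
      exact Coupled.pure ⟨h0, fun _ _ => rfl, fun _ _ => rfl⟩
    | succ r ih =>
      intro hr
      refine (ih (by omega)).bind ?_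
      rintro a t ⟨h1, h2⟩
      refine (hs r (by omega) a t h1 h2).mono fun b u _ hu hb => ⟨hb, ?_⟩
      have h3 := keeps_of_mem_support P _ u hu
      exact ⟨fun w hw => (h3.reg w hw).trans (h2.reg w hw),
        fun w hw => (h3.arr w hw).trans (h2.arr w hw)⟩
  exact (key N le_rfl).mono fun _ _ _ _ h => h.1

/-- A loop that draws one independent sample in each round. -/
theorem coupled_loop_iid {α : Type} [Fintype α] {μ : PMF α}
    (Φ : ∀ r, (Fin r → α) → Store → Prop) {x N : ℕ} {P : Prog} {s : Store} (hN : s.reg x = N)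
    (h0 : Φ 0 Fin.elim0 (s.tick 1))
    (hs : ∀ r, r < N → ∀ f t, Φ r f t → Keeps P s t →
      Coupled (exec η O P (t.tick 1)) μ (fun v => Φ (r + 1) (Fin.snoc (α := fun _ => α) f v))) :
    Coupled (exec η O (.loop x P) s) (iid (Fin N) μ) (Φ N) := by
  rw [← chain_snoc]
  refine coupled_loop (X := fun r => Fin r → α) Φ hN h0 fun r hr f t h1 h2 => ?_
  exact (hs r hr f t h1 h2).map_right fun _ _ h => h

theorem forall_support_loop (Φ : ℕ → Store → Prop) {x N : ℕ} {P : Prog} {s : Store}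
    (hN : s.reg x = N) (h0 : Φ 0 (s.tick 1))
    (hs : ∀ r, r < N → ∀ t, Φ r t → Keeps P s t →
      ∀ u ∈ (exec η O P (t.tick 1)).support, Φ (r + 1) u) :
    ∀ t ∈ (exec η O (.loop x P) s).support, Φ N t := by
  rw [exec_loop_eq_chain, hN]
  intro t ht
  refine (forall_support_chain (X := fun _ => Store) (Φ := fun r t => Φ r t ∧ Keeps P s t) N
    ⟨h0, fun _ _ => rfl, fun _ _ => rfl⟩ ?_ t ht).1
  rintro r hr t ⟨h1, h2⟩ u hu
  have h3 := keeps_of_mem_support P _ u hu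
  exact ⟨hs r hr t h1 h2 u hu, fun w hw => (h3.reg w hw).trans (h2.reg w hw),
    fun w hw => (h3.arr w hw).trans (h2.arr w hw)⟩

/-- The type `Fin (y - 1 + 1)` in the semantics avoids an empty range for `y = 0`; for positive `y`
it is the expected range. -/
theorem uniform_fin_pred {N y : ℕ} (hN : 0 < N) (hy : y = N) [Nonempty (Fin N)] :
    (PMF.uniformOfFintype (Fin (y - 1 + 1))).map Fin.val
      = (PMF.uniformOfFintype (Fin N)).map Fin.val := by
  subst hy
  obtain ⟨M, rfl⟩ : ∃ M, y = M + 1 := ⟨y - 1, by omega⟩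
  rfl

theorem exec_rand {N x y : ℕ} {s : Store} (hN : 0 < N) (hy : s.reg y = N) [Nonempty (Fin N)] :
    exec η O (.rand x y) s
      = (PMF.uniformOfFintype (Fin N)).map fun v : Fin N => (s.setReg x v).tick 1 := by
  have h : exec η O (.rand x y) s = ((PMF.uniformOfFintype (Fin (s.reg y - 1 + 1))).map
      Fin.val).map fun v : ℕ => (s.setReg x v).tick 1 := by
    rw [exec]
    rfl
  rw [h, uniform_fin_pred hN hy, PMF.map_comp]
  rfl

theorem exec_rand_bit {x y : ℕ} {s : Store} (hy : s.reg y = 2) :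
    exec η O (.rand x y) s
      = (PMF.uniformOfFintype (ZMod 2)).map fun v => (s.setReg x v.val).tick 1 :=
  exec_rand (N := 2) (by norm_num) hy

end exec

theorem Coupled.map_self {α β : Type} {μ : PMF α} {f : α → β} {Φ : α → β → Prop}
    (h : ∀ a, Φ a (f a)) : Coupled (μ.map f) μ Φ := by
  have := Coupled.of_map (ν := μ) (g := id) h
  rwa [PMF.map_id] at this

/-! ### Reading a memory after a write. -/

namespace Store

@[simp] theorem tick_reg (c : ℕ) (s : Store) : (s.tick c).reg = s.reg := rfl

@[simp] theorem tick_arr (c : ℕ) (s : Store) : (s.tick c).arr = s.arr := rfl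

@[simp] theorem setReg_reg (x v : ℕ) (s : Store) (y : ℕ) :
    (s.setReg x v).reg y = if y = x then v else s.reg y := by
  simp [setReg, Function.update_apply]

@[simp] theorem setReg_arr (x v : ℕ) (s : Store) : (s.setReg x v).arr = s.arr := rfl

@[simp] theorem setCell_reg (a i j v : ℕ) (s : Store) : (s.setCell a i j v).reg = s.reg := rfl

theorem setCell_arr (a i j v : ℕ) (s : Store) (a' i' j' : ℕ) :
    (s.setCell a i j v).arr a' i' j'
      = if a' = a ∧ i' = i ∧ j' = j then v else s.arr a' i' j' := by
  by_cases h1 : a' = a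
  · subst h1
    by_cases h2 : i' = i
    · subst h2
      simp [setCell, Function.update_apply]
    · simp [setCell, h2]
  · simp [setCell, h1]

end Store

/-! ### Straight-line programs -/

namespace Prog

/-- Neither loops nor random choices nor queries. -/
def straight : Prog → Bool
  | .rand _ _ => false
  | .noise _ => false
  | .query => false
  | .loop _ _ => false
  | .seq P Q => P.straight && Q.straight
  | .ite _ P Q => P.straight && Q.straight
  | _ => true

/-- The final memory of a straight-line program. -/
def eval : Prog → Store → Store
  | .const x c => fun s => (s.setReg x c).tick 1
  | .add x y z => fun s => (s.setReg x (s.reg y + s.reg z)).tick 1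
  | .sub x y z => fun s => (s.setReg x (s.reg y - s.reg z)).tick 1
  | .load x a i j => fun s => (s.setReg x (s.arr a (s.reg i) (s.reg j))).tick 1
  | .store a i j x => fun s => (s.setCell a (s.reg i) (s.reg j) (s.reg x)).tick 1
  | .seq P Q => fun s => Q.eval (P.eval s)
  | .ite x P Q => fun s => if 0 < s.reg x then P.eval (s.tick 1) else Q.eval (s.tick 1)
  | _ => fun s => s

end Prog

section exec

variable {m d : ℕ} {η : ℝ} {O : Solver m d}

theorem exec_straight (P : Prog) (hP : P.straight = true) :
    ∀ s, exec η O P s = PMF.pure (P.eval s) := by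
  induction P with
  | seq P Q ihP ihQ =>
    intro s
    simp only [Prog.straight, Bool.and_eq_true] at hP
    simp [exec, ihP hP.1, ihQ hP.2, Prog.eval]
  | ite x P Q ihP ihQ =>
    intro s
    simp only [Prog.straight, Bool.and_eq_true] at hP
    simp only [exec, ihP hP.1, ihQ hP.2, Prog.eval]
    split_ifs <;> rfl
  | rand | noise | query | loop => simp [Prog.straight] at hP
  | _ => intro s; simp [exec, Prog.eval]

theorem eq_eval_of_mem_support {P : Prog} (hP : P.straight = true) {s t : Store}
    (ht : t ∈ (exec η O P s).support) : t = P.eval s := by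
  rwa [exec_straight P hP, PMF.mem_support_pure_iff] at ht

/-- Run straight-line code first. -/
theorem coupled_straight_seq {α : Type} {P Q : Prog} (hP : P.straight = true) {s : Store}
    {μ : PMF α} {Φ : α → Store → Prop} (h : Coupled (exec η O Q (P.eval s)) μ Φ) :
    Coupled (exec η O (.seq P Q) s) μ Φ := by
  rw [exec]
  beta_reduce
  rw [exec_straight P hP, PMF.pure_bind]
  exact h

/-- Run straight-line code last. -/
theorem coupled_seq_straight {α : Type} {P Q : Prog} (hQ : Q.straight = true) {s : Store}
    {μ : PMF α} {Φ Ψ : α → Store → Prop} (h : Coupled (exec η O P s) μ Ψ)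
    (hΨ : ∀ a t, Ψ a t → Keeps P s t → Φ a (Q.eval t)) :
    Coupled (exec η O (.seq P Q) s) μ Φ := by
  rw [exec]
  refine (h.mono (Ψ := fun a t => Ψ a t ∧ Keeps P s t) fun a t _ ht hat =>
    ⟨hat, keeps_of_mem_support P s t ht⟩).bind_det ?_
  rintro a t ⟨h1, h2⟩ u hu
  rw [eq_eval_of_mem_support hQ hu]
  exact hΨ a t h1 h2

/-- Sequential composition. -/
theorem coupled_seq {α β : Type} {P Q : Prog} {s : Store} {μ : PMF α} {K : α → PMF β}
    {Φ : α → Store → Prop} {Ψ : β → Store → Prop} (h : Coupled (exec η O P s) μ Φ)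
    (hQ : ∀ a t, Φ a t → Keeps P s t → Coupled (exec η O Q t) (K a) Ψ) :
    Coupled (exec η O (.seq P Q) s) (μ.bind K) Ψ := by
  rw [exec]
  refine (h.mono (Ψ := fun a t => Φ a t ∧ Keeps P s t) fun a t _ ht hat =>
    ⟨hat, keeps_of_mem_support P s t ht⟩).bind ?_
  rintro a t ⟨h1, h2⟩
  exact hQ a t h1 h2

/-- Sequential composition, the first part leaving the abstract value alone. -/
theorem coupled_seq_of_forall {α : Type} {P Q : Prog} {s : Store} {μ : PMF α}
    {Φ : Store → Prop} {Ψ : α → Store → Prop} (h : ∀ t ∈ (exec η O P s).support, Φ t)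
    (hQ : ∀ t, Φ t → Keeps P s t → Coupled (exec η O Q t) μ Ψ) :
    Coupled (exec η O (.seq P Q) s) μ Ψ := by
  rw [exec]
  refine Coupled.det_bind (Φ := fun t => Φ t ∧ Keeps P s t)
    (fun t ht => ⟨h t ht, keeps_of_mem_support P s t ht⟩) ?_
  rintro t ⟨h1, h2⟩
  exact hQ t h1 h2

end exec

/-! ### The program -/

namespace Prog

/-- Register `21` gets the distance of the block index (register `11`) from the position of the
given instance (register `7`). -/
def distinct : Prog := .seq (.sub 17 11 7) (.seq (.sub 18 7 11) (.add 21 17 18))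

/-- Draw a bit of the secret (array `6`), which is `0` in the block of the given instance. -/
def secretBit : Prog :=
  .seq (.rand 16 10) (.seq (.ite 21 .skip (.const 16 0)) (.seq (.store 6 11 13 16) (.add 13 13 9)))

/-- Draw a block of the secret. -/
def secretBlock : Prog :=
  .seq (.seq distinct (.const 13 0)) (.seq (.loop 0 secretBit) (.add 11 11 9))

/-- Draw the secret. -/
def secrets : Prog := .seq (.const 11 0) (.loop 2 secretBlock)

/-- Draw an entry of the matrix (or copy it from the given one) and add its contribution to the
scalar product in register `15`. -/
def entry : Prog :=
  .seq (.rand 17 0) <| .seq (.sub 16 3 17) <| .seq (.ite 16 (.const 16 1) .skip) <|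
  .seq (.ite 21 .skip (.load 16 0 14 13)) <| .seq (.store 3 14 12 16) <|
  .seq (.load 18 6 11 13) <| .seq (.ite 18 (.add 15 15 16) .skip) <|
  .seq (.add 13 13 9) (.add 12 12 9)

/-- Draw a block of a row and its noise bit. -/
def rowBlock : Prog :=
  .seq (.seq distinct (.const 13 0)) <| .seq (.loop 0 entry) <|
  .seq (.noise 16) (.seq (.ite 21 (.add 15 15 16) .skip) (.add 11 11 9))

/-- Draw a row of the large instance. -/
def row : Prog :=
  .seq (.seq (.load 15 1 8 14) (.seq (.const 11 0) (.const 12 0))) <|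
  .seq (.loop 2 rowBlock) (.seq (.store 4 8 14 15) (.add 14 14 9))

/-- Draw the large instance. -/
def rows : Prog := .seq (.const 14 0) (.loop 1 row)

/-- Compare a bit of the answer with the secret. -/
def compareBit : Prog :=
  .seq (.load 16 5 8 12) <| .seq (.load 17 6 11 13) <| .seq (.sub 18 16 17) <|
  .seq (.sub 16 17 16) <| .seq (.add 20 20 18) <| .seq (.add 20 20 16) <|
  .seq (.add 13 13 9) (.add 12 12 9)

/-- Compare a block of the answer with the secret; if they differ, reject (register `19`) with
probability one half. The block of the given instance is not compared. -/
def checkBlock : Prog :=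
  .seq (.seq distinct (.seq (.const 13 0) (.seq (.const 20 0) (.ite 21 .skip (.add 22 12 8))))) <|
  .seq (.loop 0 compareBit) <| .seq (.rand 16 10) <|
  .seq (.ite 21 (.ite 20 (.ite 16 (.const 19 0) .skip) .skip) .skip) (.add 11 11 9)

/-- Decide whether to accept the answer. -/
def check : Prog :=
  .seq (.seq (.const 19 1) (.seq (.const 11 0) (.const 12 0))) (.loop 2 checkBlock)

/-- Copy a bit of the answer to the output. -/
def copyBit : Prog :=
  .seq (.load 16 5 8 22) <| .seq (.store 2 8 13 16) <| .seq (.add 13 13 9) (.add 22 22 9)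

/-- If the answer is accepted, then its block at the position of the given instance becomes the
output. -/
def output : Prog := .ite 19 (.seq (.const 13 0) (.loop 0 copyBit)) .skip

/-- Hide the given instance in a large one, at a random position, and query the oracle. -/
def round : Prog :=
  .seq (.rand 7 2) <| .seq secrets <| .seq rows <| .seq .query <| .seq check output

/-- The last accepted answer among `8 ⌈1/ε⌉ ⌈1/δ⌉` rounds. -/
def solver : Prog :=
  .seq (.seq (.const 6 8) (.seq (.const 9 1) (.const 10 2)))
    (.loop 6 (.loop 4 (.loop 5 round)))

end Prog

/-! ### Drawing the secrets. -/

section verification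

variable {m d : ℕ} {η : ℝ} {O : Solver m d}

/-- The registers that hold constants during a round, and the given instance. -/
structure Context (n m k σ : ℕ) (A : ℕ → ℕ → ℕ) (b : ℕ → ℕ → ℕ) (s : Store) : Prop where
  r0 : s.reg 0 = n
  r1 : s.reg 1 = m
  r2 : s.reg 2 = k
  r3 : s.reg 3 = σ
  r8 : s.reg 8 = 0
  r9 : s.reg 9 = 1
  r10 : s.reg 10 = 2
  a0 : s.arr 0 = A
  a1 : s.arr 1 = b

theorem Context.of_keeps {n m k σ : ℕ} {A b : ℕ → ℕ → ℕ} {s t : Store}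
    (h : Context n m k σ A b s) {P : Prog} (hP : ∀ x ∈ [0, 1, 2, 3, 8, 9, 10], x ∉ P.regs)
    (hP' : ∀ x ∈ [0, 1], x ∉ P.arrs) (hk : Keeps P s t) : Context n m k σ A b t := by
  simp only [List.mem_cons, List.not_mem_nil, or_false, forall_eq_or_imp, forall_eq] at hP hP'
  obtain ⟨h0, h1, h2, h3, h8, h9, h10⟩ := hP
  exact ⟨(hk.reg _ h0).trans h.r0, (hk.reg _ h1).trans h.r1, (hk.reg _ h2).trans h.r2,
    (hk.reg _ h3).trans h.r3, (hk.reg _ h8).trans h.r8, (hk.reg _ h9).trans h.r9,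
    (hk.reg _ h10).trans h.r10, (hk.arr _ hP'.1).trans h.a0, (hk.arr _ hP'.2).trans h.a1⟩

theorem Context.tick {n m k σ : ℕ} {A b : ℕ → ℕ → ℕ} {s : Store}
    (h : Context n m k σ A b s) (c : ℕ) : Context n m k σ A b (s.tick c) :=
  ⟨h.1, h.2, h.3, h.4, h.5, h.6, h.7, h.8, h.9⟩

theorem Context.of_eval {n m k σ : ℕ} {A b : ℕ → ℕ → ℕ} {s : Store}
    (h : Context n m k σ A b s) {P : Prog} (hs : P.straight = true)
    (hP : ∀ x ∈ [0, 1, 2, 3, 8, 9, 10], x ∉ P.regs)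
    (hP' : ∀ x ∈ [0, 1], x ∉ P.arrs) : Context n m k σ A b (P.eval s) := by
  -- Straight-line code ignores the noise rate and the oracle, so the frame property for arbitrary
  -- dummy parameters suffices.
  refine h.of_keeps hP hP' (keeps_of_mem_support (η := 0) (O := fun _ _ => PMF.pure 0) (m := 0)
    (d := 0) P s _ ?_)
  rw [exec_straight P hs]
  simp

variable {n k σ : ℕ} {A b : ℕ → ℕ → ℕ} {j : ℕ}

/-- A bit is drawn even in block `j`, where it is then replaced by `0`. Thus every block follows the
same law, and the stored secret contributes nothing to scalar products in block `j`. -/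
theorem coupled_loop_secretBit {s : Store} (h : Context n m k σ A b s) {c : ℕ}
    (h11 : s.reg 11 = c) (h13 : s.reg 13 = 0) (h21 : s.reg 21 = 0 ↔ c = j) :
    Coupled (exec η O (.loop 0 .secretBit) s) (iid (Fin n) (PMF.uniformOfFintype (ZMod 2)))
      (fun f t => (∀ i : Fin n, t.arr 6 c i = if c = j then 0 else (f i).val) ∧
        ∀ x, x ≠ c → t.arr 6 x = s.arr 6 x) := by
  refine (coupled_loop_iid (fun q f t => t.reg 13 = q ∧
    (∀ i : Fin q, t.arr 6 c i = if c = j then 0 else (f i).val) ∧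
        ∀ x, x ≠ c → t.arr 6 x = s.arr 6 x) h.r0 ?_ ?_).mono fun _ _ _ _ h => h.2
  · exact ⟨h13, fun i => i.elim0, fun _ _ => rfl⟩
  · rintro q hq f t ⟨t13, t6, t6'⟩ hk
    have ht := h.of_keeps (by decide) (by decide) hk
    have t11 := (hk.reg 11 (by decide)).trans h11
    have t21 := hk.reg 21 (by decide)
    rw [Prog.secretBit]
    refine coupled_seq_straight rfl (Ψ := fun v u => u = (((t.tick 1).setReg 16 v.val).tick 1))
      ?_ ?_
    · rw [exec_rand_bit (s := t.tick 1) ht.r10]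
      exact Coupled.map_self fun _ => rfl
    · rintro v u rfl -
      rw [Fin.forall_fin_succ']
      by_cases hc : c = j
      · have h21' := h21.2 hc
        subst hc
        refine ⟨?_, ⟨?_, ?_⟩, ?_⟩
        · simp [Prog.eval, t13, ht.r9, t21, h21']
        · intro i
          have := i.2.ne
          simpa [Prog.eval, t13, t11, t21, h21', Store.setCell_arr, this] using t6 i
        · simp [Prog.eval, t13, t11, t21, h21', Store.setCell_arr]
        · intro x hx
          rw [← t6' x hx]
          ext y
          simp [Prog.eval, t11, t21, h21', Store.setCell_arr, hx]
      · have h21' : 0 < s.reg 21 := Nat.pos_of_ne_zero fun h => hc (h21.1 h)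
        refine ⟨?_, ⟨?_, ?_⟩, ?_⟩
        · simp [Prog.eval, t13, ht.r9, t21, h21']
        · intro i
          have := i.2.ne
          simpa [Prog.eval, t13, t11, t21, h21', Store.setCell_arr, this] using t6 i
        · simp [Prog.eval, t13, t11, t21, h21', Store.setCell_arr, hc]
        · intro x hx
          rw [← t6' x hx]
          ext y
          simp [Prog.eval, t11, t21, h21', Store.setCell_arr, hx]

/-- With truncated subtraction, `(c - j) + (j - c)` vanishes only for `c = j`. -/
theorem eval_distinct_reg {s : Store} (c : ℕ) (h11 : s.reg 11 = c) (h7 : s.reg 7 = j) :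
    (Prog.distinct.eval s).reg 21 = 0 ↔ c = j := by
  simp [Prog.distinct, Prog.eval, h11, h7]
  omega

theorem coupled_secrets {s : Store} (h : Context n m k σ A b s) (h7 : s.reg 7 = j) :
    Coupled (exec η O .secrets s) (iid (Fin k) (iid (Fin n) (PMF.uniformOfFintype (ZMod 2))))
      (fun S t => ∀ (c : Fin k) (i : Fin n), t.arr 6 c i = if (c : ℕ) = j then 0
        else (S c i).val) := by
  rw [Prog.secrets]
  refine coupled_straight_seq rfl ?_
  have h' := h.of_eval (P := .const 11 0) rfl (by decide) (by decide)
  refine (coupled_loop_iid (fun q S t => t.reg 11 = q ∧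
    ∀ (c : Fin q) (i : Fin n), t.arr 6 c i = if (c : ℕ) = j then 0
        else (S c i).val) h'.r2 ?_ ?_).mono fun _ _ _ _ h => h.2
  · exact ⟨by simp [Prog.eval], fun i => i.elim0⟩
  · rintro q hq f t ⟨t11, t6⟩ hk
    have ht := h'.of_keeps (by decide) (by decide) hk
    have t7 : t.reg 7 = j := by
      rw [hk.reg 7 (by decide)]
      simpa [Prog.eval] using h7
    rw [Prog.secretBlock]
    refine coupled_straight_seq rfl ?_
    have ht' := (ht.tick 1).of_eval (P := .seq .distinct (.const 13 0)) rfl (by decide) (by decide)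
    refine coupled_seq_straight rfl (coupled_loop_secretBit (c := q) (j := j) ht'
      (by simp [Prog.eval, Prog.distinct, t11]) (by simp [Prog.eval])
      (by simpa [Prog.eval] using eval_distinct_reg (s := t.tick 1) q t11 t7)) ?_
    rintro v u ⟨u6, u6'⟩ hu
    have u11 : u.reg 11 = q := by
      rw [hu.reg 11 (by decide)]
      simp [Prog.eval, Prog.distinct, t11]
    refine ⟨?_, ?_⟩
    · simp [Prog.eval, u11, (ht'.of_keeps (by decide) (by decide) hu).r9]
    · rw [Fin.forall_fin_succ']
      constructor
      · intro c i
        have := u6' c c.2.ne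
        have e := t6 c i
        simp [Prog.eval, this, Prog.distinct, e]
      · intro i
        simpa [Prog.eval] using u6 i

end verification

/-! ### Drawing the rows of the large instance. -/

section verification

variable {m d : ℕ} {η : ℝ} {O : Solver m d} {n k σ : ℕ} {A b : ℕ → ℕ → ℕ} {j : ℕ}

/-- The relation remembers the uniform number `w`, because the program forms the bit only later, by
testing whether `σ - w` is positive. -/
theorem coupled_rand_ber {s : Store} (hn : 0 < n) (hσ : σ ≤ n) {x y : ℕ} (h : s.reg y = n) :
    Coupled (exec η O (.rand x y) s) (ber ((σ : ℝ) / n)) (fun v u => ∃ w : ℕ,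
      u = (s.setReg x w).tick 1 ∧ v = if w < σ then 1 else 0) := by
  have : Nonempty (Fin n) := ⟨⟨0, hn⟩⟩
  rw [← uniform_threshold_eq_ber hn hσ, exec_rand hn h]
  exact Coupled.of_map fun w => ⟨w, rfl, rfl⟩

/-- In block `j` the entry used is `A r q` instead of `v`, but the stored secret bit is `0` there
(`h6'`), so one formula for register `15` covers both cases. -/
theorem coupled_entry {s : Store} (h : Context n m k σ A b s) (hn : 0 < n) (hσ : σ ≤ n)
    {r c q : ℕ} (h14 : s.reg 14 = r) (h11 : s.reg 11 = c) (h12 : s.reg 12 = n * c + q)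
    (h13 : s.reg 13 = q) (h21 : s.reg 21 = 0 ↔ c = j) (h6 : s.arr 6 c q ≤ 1)
    (h6' : c = j → s.arr 6 c q = 0) :
    Coupled (exec η O .entry s) (ber ((σ : ℝ) / n)) (fun v t => t.reg 13 = q + 1 ∧
      t.reg 12 = n * c + q + 1 ∧
      (t.reg 15 : ZMod 2) = s.reg 15 + v * s.arr 6 c q ∧
      ∀ x y, t.arr 3 x y = if x = r ∧ y = n * c + q then if c = j then A r q else v.val
        else s.arr 3 x y) := by
  rw [Prog.entry]
  refine coupled_seq_straight rfl (coupled_rand_ber hn hσ h.r0) ?_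
  rintro v u ⟨w, rfl, rfl⟩ -
  have h0 := h.a0
  have h3 := h.r3
  have h9 := h.r9
  rcases Nat.lt_or_ge w σ with hw | hw
  · have hw' : ¬ σ ≤ w := by omega
    by_cases hc : c = j
    · have h21' := h21.2 hc
      have h6'' := h6' hc
      subst hc
      simp [Prog.eval, h0, h3, h9, h11, h12, h13, h14, h21', h6'', hw, Store.setCell_arr]
    · have h21' : 0 < s.reg 21 := Nat.pos_of_ne_zero fun h => hc (h21.1 h)
      rcases Nat.le_one_iff_eq_zero_or_eq_one.1 h6 with h6'' | h6'' <;>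
      simp [Prog.eval, h3, h9, h11, h12, h13, h14, h21', h6'', hw, hc, Store.setCell_arr,
        ZMod.val_one]
  · have hw' : ¬ w < σ := by omega
    have hw'' : σ - w = 0 := by omega
    by_cases hc : c = j
    · have h21' := h21.2 hc
      have h6'' := h6' hc
      subst hc
      simp [Prog.eval, h0, h3, h9, h11, h12, h13, h14, h21', h6'', hw', Store.setCell_arr]
    · have h21' : 0 < s.reg 21 := Nat.pos_of_ne_zero fun h => hc (h21.1 h)
      rcases Nat.le_one_iff_eq_zero_or_eq_one.1 h6 with h6'' | h6'' <;>
      simp [Prog.eval, h3, h9, h11, h12, h13, h14, h21', h6'', hw', hw'', hc, Store.setCell_arr]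

/-- The last clause protects the other rows and the blocks to the left, which are already written.
-/
theorem coupled_loop_entry {s : Store} (h : Context n m k σ A b s) (hn : 0 < n) (hσ : σ ≤ n)
    {r c : ℕ} (h14 : s.reg 14 = r) (h11 : s.reg 11 = c) (h12 : s.reg 12 = n * c)
    (h13 : s.reg 13 = 0) (h21 : s.reg 21 = 0 ↔ c = j) (h6 : ∀ i < n, s.arr 6 c i ≤ 1)
    (h6' : c = j → ∀ i < n, s.arr 6 c i = 0) :
    Coupled (exec η O (.loop 0 .entry) s) (iid (Fin n) (ber ((σ : ℝ) / n)))
      (fun (v : Fin n → ZMod 2) t => t.reg 12 = n * c + n ∧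
      (t.reg 15 : ZMod 2) = s.reg 15 + ∑ i, v i * (s.arr 6 c i : ZMod 2) ∧
      (∀ i : Fin n, t.arr 3 r (n * c + i) = if c = j then A r i else (v i).val) ∧
      ∀ x y, x ≠ r ∨ y < n * c → t.arr 3 x y = s.arr 3 x y) := by
  refine (coupled_loop_iid (fun q (v : Fin q → ZMod 2) t => t.reg 13 = q ∧ t.reg 12 = n * c + q ∧
      (t.reg 15 : ZMod 2) = s.reg 15 + ∑ i, v i * (s.arr 6 c i : ZMod 2) ∧
      (∀ i : Fin q, t.arr 3 r (n * c + i) = if c = j then A r i else (v i).val) ∧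
      ∀ x y, x ≠ r ∨ y < n * c → t.arr 3 x y = s.arr 3 x y) h.r0 ?_ ?_).mono
    fun _ _ _ _ h => h.2
  · exact ⟨h13, by simp [h12], by simp, fun i => i.elim0, fun _ _ _ => rfl⟩
  · rintro q hq f t ⟨t13, t12, t15, t3, t3'⟩ hk
    have ht := h.of_keeps (by decide) (by decide) hk
    have t6 : t.arr 6 = s.arr 6 := hk.arr 6 (by decide)
    refine (coupled_entry (ht.tick 1) hn hσ (j := j) (r := r) (c := c) (q := q)
      ((hk.reg 14 (by decide)).trans h14) ((hk.reg 11 (by decide)).trans h11) t12 t13 ?_ ?_ ?_).mono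
      ?_
    · simpa [hk.reg 21 (by decide)] using h21
    · simpa [t6] using h6 q hq
    · simpa [t6] using fun hc => h6' hc q hq
    · rintro v u - - ⟨u13, u12, u15, u3⟩
      refine ⟨u13, u12, ?_, ?_, ?_⟩
      · rw [u15, Fin.sum_univ_castSucc]
        simp [t15, t6, add_assoc]
      · rw [Fin.forall_fin_succ']
        constructor
        · intro i
          have := i.2.ne
          simpa [u3, this] using t3 i
        · simp [u3]
      · intro x y hxy
        rw [u3, if_neg, ← t3' x y hxy]
        · rfl
        · rintro ⟨rfl, rfl⟩
          rcases hxy with hxy | hxy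
          · exact hxy rfl
          · omega

end verification

/-- The law of a row of a block and its noise bit. -/
def rowLaw (η : ℝ) (σ n : ℕ) : PMF ((Fin n → ZMod 2) × ZMod 2) :=
  (iid (Fin n) (ber ((σ : ℝ) / n))).bind fun v => (ber η).map (Prod.mk v)

section verification

variable {m d : ℕ} {η : ℝ} {O : Solver m d} {n k σ : ℕ} {A b : ℕ → ℕ → ℕ} {j : ℕ}

/-- The noise bit of block `j` is drawn but not added, since the given right hand side contains its
own noise. -/
theorem coupled_rowBlock {s : Store} (h : Context n m k σ A b s) (hn : 0 < n) (hσ : σ ≤ n)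
    {r c : ℕ} (h7 : s.reg 7 = j) (h14 : s.reg 14 = r) (h11 : s.reg 11 = c)
    (h12 : s.reg 12 = n * c) (h6 : ∀ i < n, s.arr 6 c i ≤ 1)
    (h6' : c = j → ∀ i < n, s.arr 6 c i = 0) :
    Coupled (exec η O .rowBlock s) (rowLaw η σ n)
      (fun x t => t.reg 11 = c + 1 ∧ t.reg 12 = n * (c + 1) ∧
      (t.reg 15 : ZMod 2) = s.reg 15 + (∑ i, x.1 i * (s.arr 6 c i : ZMod 2) +
        if c = j then 0 else x.2) ∧
      (∀ i : Fin n, t.arr 3 r (n * c + i) = if c = j then A r i else (x.1 i).val) ∧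
      ∀ x y, x ≠ r ∨ y < n * c → t.arr 3 x y = s.arr 3 x y) := by
  rw [Prog.rowBlock]
  refine coupled_straight_seq rfl ?_
  have h' := h.of_eval (P := .seq .distinct (.const 13 0)) rfl (by decide) (by decide)
  have h21 := eval_distinct_reg (s := s) c h11 h7
  set s' := (Prog.seq .distinct (.const 13 0)).eval s with hs'
  have e6 : s'.arr = s.arr := rfl
  have e11 : s'.reg 11 = c := by simp [hs', Prog.eval, Prog.distinct, h11]
  have e12 : s'.reg 12 = n * c := by simp [hs', Prog.eval, Prog.distinct, h12]
  have e13 : s'.reg 13 = 0 := by simp [hs', Prog.eval]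
  have e14 : s'.reg 14 = r := by simp [hs', Prog.eval, Prog.distinct, h14]
  have e15 : s'.reg 15 = s.reg 15 := by simp [hs', Prog.eval, Prog.distinct]
  have e21 : s'.reg 21 = 0 ↔ c = j := by simpa [hs', Prog.eval] using h21
  refine coupled_seq (coupled_loop_entry h' hn hσ e14 e11 e12 e13 e21 h6 h6') ?_
  rintro v t ⟨t12, t15, t3, t3'⟩ hk
  have ht := h'.of_keeps (by decide) (by decide) hk
  have t11 := (hk.reg 11 (by decide)).trans e11
  have t21 : t.reg 21 = 0 ↔ c = j := by rw [hk.reg 21 (by decide), e21]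
  refine coupled_seq_straight (Ψ := fun x u => ∃ e : ZMod 2, x = (v, e) ∧
    u = (t.setReg 16 e.val).tick 1) rfl ?_ ?_
  · rw [exec]
    exact Coupled.of_map fun e => ⟨e, rfl, rfl⟩
  · rintro x u ⟨e, rfl, rfl⟩ -
    by_cases hc : c = j
    · have h21' := t21.2 hc
      simp only [Prog.eval, Store.tick_reg, Store.setReg_reg, h21']
      refine ⟨by simp [t11, ht.r9], by simp [t12, mul_add], ?_, t3, t3'⟩
      rw [e15] at t15
      simp [hc, t15, e6]
    · have h21' : 0 < t.reg 21 := Nat.pos_of_ne_zero fun h => hc (t21.1 h)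
      rw [e15] at t15
      simp only [Prog.eval, Store.tick_reg, Store.setReg_reg]
      simp only [show (21 : ℕ) = 16 ↔ False by decide, if_false, h21', if_true]
      refine ⟨by simp [t11, ht.r9], by simp [t12, mul_add], ?_, t3, t3'⟩
      simp [hc, t15, e6, add_assoc]

/-- Register `15` starts from the given right hand side, which stands for the whole contribution of
block `j`. -/
theorem coupled_row {s : Store} (h : Context n m k σ A b s) (hn : 0 < n) (hσ : σ ≤ n)
    {r : ℕ} (h7 : s.reg 7 = j) (h14 : s.reg 14 = r) (h6 : ∀ c < k, ∀ i < n, s.arr 6 c i ≤ 1)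
    (h6' : j < k → ∀ i < n, s.arr 6 j i = 0) :
    Coupled (exec η O .row s) (iid (Fin k) (rowLaw η σ n))
      (fun x t => t.reg 14 = r + 1 ∧
      (t.arr 4 0 r : ZMod 2) = b 0 r + ∑ c : Fin k, (∑ i, (x c).1 i * (s.arr 6 c i : ZMod 2) +
        if (c : ℕ) = j then 0 else (x c).2) ∧
      (∀ y, y ≠ r → t.arr 4 0 y = s.arr 4 0 y) ∧
      (∀ (c : Fin k) (i : Fin n), t.arr 3 r (n * c + i)
        = if (c : ℕ) = j then A r i else ((x c).1 i).val) ∧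
      ∀ x y, x ≠ r → t.arr 3 x y = s.arr 3 x y) := by
  rw [Prog.row]
  refine coupled_straight_seq rfl ?_
  have h' := h.of_eval (P := .seq (.load 15 1 8 14) (.seq (.const 11 0) (.const 12 0))) rfl
    (by decide) (by decide)
  set s' := (Prog.seq (.load 15 1 8 14) (.seq (.const 11 0) (.const 12 0))).eval s with hs'
  have e6 : s'.arr = s.arr := rfl
  have e7 : s'.reg 7 = j := by simp [hs', Prog.eval, h7]
  have e11 : s'.reg 11 = 0 := by simp [hs', Prog.eval]
  have e12 : s'.reg 12 = 0 := by simp [hs', Prog.eval]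
  have e14 : s'.reg 14 = r := by simp [hs', Prog.eval, h14]
  have e15 : s'.reg 15 = b 0 r := by simp [hs', Prog.eval, h14, h.r8, h.a1]
  refine coupled_seq_straight rfl (coupled_loop_iid (N := k)
    (fun q (x : Fin q → (Fin n → ZMod 2) × ZMod 2) t =>
      t.reg 11 = q ∧ t.reg 12 = n * q ∧
      (t.reg 15 : ZMod 2) = b 0 r + ∑ c : Fin q, (∑ i, (x c).1 i * (s.arr 6 c i : ZMod 2) +
        if (c : ℕ) = j then 0 else (x c).2) ∧
      (∀ (c : Fin q) (i : Fin n), t.arr 3 r (n * c + i)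
        = if (c : ℕ) = j then A r i else ((x c).1 i).val) ∧
      ∀ x y, x ≠ r → t.arr 3 x y = s.arr 3 x y) h'.r2 ?_ ?_) ?_
  · exact ⟨e11, by simp [e12], by simp [e15], fun c => c.elim0, fun _ _ _ => rfl⟩
  · rintro q hq x t ⟨t11, t12, t15, t3, t3'⟩ hk
    have ht := h'.of_keeps (by decide) (by decide) hk
    have t6 : t.arr 6 = s.arr 6 := hk.arr 6 (by decide)
    refine (coupled_rowBlock (ht.tick 1) hn hσ (j := j) (r := r) (c := q)
      ((hk.reg 7 (by decide)).trans e7) ((hk.reg 14 (by decide)).trans e14) t11 t12 ?_ ?_).mono ?_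
    · simpa [t6] using h6 q hq
    · rintro rfl
      simpa [t6] using h6' hq
    · rintro v u - - ⟨u11, u12, u15, u3, u3'⟩
      refine ⟨u11, u12, ?_, ?_, ?_⟩
      · rw [u15, Fin.sum_univ_castSucc]
        simp [t15, t6, add_assoc]
      · rw [Fin.forall_fin_succ']
        constructor
        · intro c i
          -- The earlier block `c` ends before column `n * q`, where the new one starts.
          have h1 : n * (c : ℕ) + i < n * q := by
            have h2 : n * ((c : ℕ) + 1) ≤ n * q := Nat.mul_le_mul_left n c.2
            have h3 := i.2
            rw [mul_add] at h2
            omega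
          have h4 := u3' r (n * c + i) (.inr h1)
          simpa [h4] using t3 c i
        · simpa using u3
      · intro x y hxy
        rw [u3' x y (.inl hxy)]
        exact t3' x y hxy
  · rintro x t ⟨t11, t12, t15, t3, t3'⟩ hk
    have ht := h'.of_keeps (by decide) (by decide) hk
    have t14 : t.reg 14 = r := (hk.reg 14 (by decide)).trans e14
    have t4 : t.arr 4 = s.arr 4 := hk.arr 4 (by decide)
    refine ⟨?_, ?_, ?_, ?_, ?_⟩
    · simp [Prog.eval, t14, ht.r9]
    · simp [Prog.eval, t14, ht.r8, Store.setCell_arr, t15]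
    · intro y hy
      simp [Prog.eval, t14, ht.r8, Store.setCell_arr, t4, hy]
    · simpa [Prog.eval, Store.setCell_arr] using t3
    · simpa [Prog.eval, Store.setCell_arr] using t3'

theorem coupled_rows {s : Store} (h : Context n m k σ A b s) (hn : 0 < n) (hσ : σ ≤ n)
    (h7 : s.reg 7 = j) (h6 : ∀ c < k, ∀ i < n, s.arr 6 c i ≤ 1)
    (h6' : j < k → ∀ i < n, s.arr 6 j i = 0) :
    Coupled (exec η O .rows s) (iid (Fin m) (iid (Fin k) (rowLaw η σ n)))
      (fun x t =>
      (∀ r : Fin m, (t.arr 4 0 r : ZMod 2)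
        = b 0 r + ∑ c : Fin k, (∑ i, (x r c).1 i * (s.arr 6 c i : ZMod 2) +
        if (c : ℕ) = j then 0 else (x r c).2)) ∧
      (∀ (r : Fin m) (c : Fin k) (i : Fin n), t.arr 3 r (n * c + i)
        = if (c : ℕ) = j then A r i else ((x r c).1 i).val)) := by
  rw [Prog.rows]
  refine coupled_straight_seq rfl ?_
  have h' := h.of_eval (P := .const 14 0) rfl (by decide) (by decide)
  set s' := (Prog.const 14 0).eval s with hs'
  have e6 : s'.arr = s.arr := rfl
  have e7 : s'.reg 7 = j := by simp [hs', Prog.eval, h7]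
  have e14 : s'.reg 14 = 0 := by simp [hs', Prog.eval]
  refine (coupled_loop_iid (N := m)
    (fun q (x : Fin q → Fin k → (Fin n → ZMod 2) × ZMod 2) t => t.reg 14 = q ∧
      (∀ r : Fin q, (t.arr 4 0 r : ZMod 2)
        = b 0 r + ∑ c : Fin k, (∑ i, (x r c).1 i * (s.arr 6 c i : ZMod 2) +
        if (c : ℕ) = j then 0 else (x r c).2)) ∧
      (∀ (r : Fin q) (c : Fin k) (i : Fin n), t.arr 3 r (n * c + i)
        = if (c : ℕ) = j then A r i else ((x r c).1 i).val)) h'.r1 ?_ ?_).mono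
    fun _ _ _ _ h => h.2
  · exact ⟨e14, fun c => c.elim0, fun c => c.elim0⟩
  · rintro q hq x t ⟨t14, t4, t3⟩ hk
    have ht := h'.of_keeps (by decide) (by decide) hk
    have t6 : t.arr 6 = s.arr 6 := hk.arr 6 (by decide)
    refine (coupled_row (ht.tick 1) hn hσ (j := j) (r := q)
      ((hk.reg 7 (by decide)).trans e7) t14 ?_ ?_).mono ?_
    · simpa [t6] using h6
    · simpa [t6] using h6'
    · rintro v u - - ⟨u14, u4, u4', u3, u3'⟩
      refine ⟨u14, ?_, ?_⟩
      · rw [Fin.forall_fin_succ']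
        constructor
        · intro r
          have := u4' r r.2.ne
          simpa [this] using t4 r
        · simpa [t6] using u4
      · rw [Fin.forall_fin_succ']
        constructor
        · intro r c i
          have := u3' r (n * c + i) r.2.ne
          simpa [this] using t3 r c i
        · simpa using u3

end verification

/-! ### Checking the answer and writing the output. -/

section verification

variable {m d : ℕ} {η : ℝ} {O : Solver m d} {n k σ : ℕ} {A b : ℕ → ℕ → ℕ} {j : ℕ}

/-- Register `20` adds up the distances between the bits of the answer and of the secret. -/
theorem forall_loop_compareBit {s : Store} (h : Context n m k σ A b s) {c : ℕ}
    (h11 : s.reg 11 = c) (h12 : s.reg 12 = n * c) (h13 : s.reg 13 = 0) (h20 : s.reg 20 = 0) :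
    ∀ t ∈ (exec η O (.loop 0 .compareBit) s).support, t.reg 12 = n * c + n ∧
      (t.reg 20 = 0 ↔ ∀ i < n, s.arr 5 0 (n * c + i) = s.arr 6 c i) := by
  intro t ht
  refine (forall_support_loop (fun q t => t.reg 13 = q ∧ t.reg 12 = n * c + q ∧
      (t.reg 20 = 0 ↔ ∀ i < q, s.arr 5 0 (n * c + i) = s.arr 6 c i)) h.r0 ?_ ?_ t ht).2
  · exact ⟨h13, by simp [h12], by simp [h20]⟩
  · rintro q hq t ⟨t13, t12, t20⟩ hk u hu
    have ht := h.of_keeps (by decide) (by decide) hk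
    have t5 : t.arr 5 = s.arr 5 := hk.arr 5 (by decide)
    have t6 : t.arr 6 = s.arr 6 := hk.arr 6 (by decide)
    have t11 : t.reg 11 = c := (hk.reg 11 (by decide)).trans h11
    rw [eq_eval_of_mem_support rfl hu]
    refine ⟨by simp [Prog.compareBit, Prog.eval, t13, ht.r9],
      by simp [Prog.compareBit, Prog.eval, t12, ht.r9, add_assoc], ?_⟩
    have e : (Prog.compareBit.eval (t.tick 1)).reg 20 = t.reg 20
        + (s.arr 5 0 (n * c + q) - s.arr 6 c q) + (s.arr 6 c q - s.arr 5 0 (n * c + q)) := by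
      simp [Prog.compareBit, Prog.eval, t5, t6, t11, t12, t13, ht.r8]
    rw [e, Nat.forall_lt_succ_right, ← t20]
    omega

/-- A fresh coin is tossed for every block, needed or not, so that the coins form one independent
family. Register `22` records where block `j` begins. -/
theorem coupled_checkBlock {s : Store} (h : Context n m k σ A b s) {c : ℕ}
    (h7 : s.reg 7 = j) (h11 : s.reg 11 = c) (h12 : s.reg 12 = n * c) :
    Coupled (exec η O .checkBlock s) (PMF.uniformOfFintype (ZMod 2))
      (fun v t => t.reg 11 = c + 1 ∧ t.reg 12 = n * (c + 1) ∧
        (0 < t.reg 19 ↔ 0 < s.reg 19 ∧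
          (c ≠ j → v = 0 ∨ ∀ i < n, s.arr 5 0 (n * c + i) = s.arr 6 c i)) ∧
        t.reg 22 = if c = j then n * c else s.reg 22) := by
  rw [Prog.checkBlock]
  refine coupled_straight_seq rfl ?_
  set P := Prog.seq .distinct (.seq (.const 13 0) (.seq (.const 20 0)
    (.ite 21 .skip (.add 22 12 8)))) with hP
  have h' := h.of_eval (P := P) rfl (by decide) (by decide)
  have h21 := eval_distinct_reg (s := s) c h11 h7
  set s' := P.eval s with hs'
  have key : s'.arr = s.arr ∧ s'.reg 11 = c ∧ s'.reg 12 = n * c ∧ s'.reg 13 = 0 ∧ s'.reg 20 = 0 ∧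
      s'.reg 19 = s.reg 19 ∧ s'.reg 22 = (if c = j then n * c else s.reg 22) ∧
      (s'.reg 21 = 0 ↔ c = j) := by
    have h8 := h.r8
    generalize hd : (Prog.distinct.eval s) = s₁ at *
    have d1 : s₁.arr = s.arr := by rw [← hd]; rfl
    have d11 : s₁.reg 11 = c := by rw [← hd]; simp [Prog.eval, Prog.distinct, h11]
    have d12 : s₁.reg 12 = n * c := by rw [← hd]; simp [Prog.eval, Prog.distinct, h12]
    have d19 : s₁.reg 19 = s.reg 19 := by rw [← hd]; simp [Prog.eval, Prog.distinct]
    have d22 : s₁.reg 22 = s.reg 22 := by rw [← hd]; simp [Prog.eval, Prog.distinct]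
    have d8 : s₁.reg 8 = 0 := by rw [← hd]; simp [Prog.eval, Prog.distinct, h8]
    by_cases h0 : s₁.reg 21 = 0
    · have hc := h21.1 h0
      simp [hs', hP, Prog.eval, hd, h0, hc, d1, d11, d12, d19, d8]
    · have h0' := Nat.pos_of_ne_zero h0
      have hc : c ≠ j := fun hc => h0 (h21.2 hc)
      simp [hs', hP, Prog.eval, hd, h0, h0', hc, d1, d11, d12, d19, d22]
  obtain ⟨e, e11, e12, e13, e20, e19, e22, h21'⟩ := key
  refine coupled_seq_of_forall (forall_loop_compareBit h' e11 e12 e13 e20) ?_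
  rintro t ⟨t12, t20⟩ hk
  have ht := h'.of_keeps (by decide) (by decide) hk
  have t11 : t.reg 11 = c := (hk.reg 11 (by decide)).trans e11
  have t19 : t.reg 19 = s.reg 19 := (hk.reg 19 (by decide)).trans e19
  have t21 : t.reg 21 = 0 ↔ c = j := by rw [hk.reg 21 (by decide), h21']
  have t22 := (hk.reg 22 (by decide)).trans e22
  rw [e] at t20
  refine coupled_seq_straight rfl (Ψ := fun v u => u = ((t.setReg 16 v.val).tick 1)) ?_ ?_
  · rw [exec_rand_bit ht.r10]
    exact Coupled.map_self fun _ => rfl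
  · rintro v u rfl -
    rw [← t20]
    by_cases hc : c = j
    · have t21' := t21.2 hc
      simp [Prog.eval, t21', hc, t11, ht.r9, t12, mul_add, t19, t22]
    · have t21' : 0 < t.reg 21 := Nat.pos_of_ne_zero fun h => hc (t21.1 h)
      by_cases h20 : t.reg 20 = 0
      · simp [Prog.eval, t21', hc, t11, ht.r9, t12, mul_add, t19, t22, h20]
      · have h20' : 0 < t.reg 20 := Nat.pos_of_ne_zero h20
        have hv : v.val = 0 ↔ v = 0 := ZMod.val_eq_zero v
        by_cases hv0 : v = 0
        · simp [Prog.eval, t21', hc, t11, ht.r9, t12, mul_add, t19, t22, h20', hv0]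
        · have hv' : 0 < v.val := Nat.pos_of_ne_zero fun h => hv0 (hv.1 h)
          simp [Prog.eval, t21', hc, t11, ht.r9, t12, mul_add, t22, h20, h20', hv0, hv']

theorem coupled_check {s : Store} (h : Context n m k σ A b s) (h7 : s.reg 7 = j) :
    Coupled (exec η O .check s) (iid (Fin k) (PMF.uniformOfFintype (ZMod 2)))
      (fun v t => (0 < t.reg 19 ↔ ∀ c : Fin k, (c : ℕ) ≠ j → v c = 0 ∨
          ∀ i < n, s.arr 5 0 (n * c + i) = s.arr 6 c i) ∧
        (j < k → t.reg 22 = n * j)) := by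
  rw [Prog.check]
  refine coupled_straight_seq rfl ?_
  set P := Prog.seq (.const 19 1) (.seq (.const 11 0) (.const 12 0)) with hP
  have h' := h.of_eval (P := P) rfl (by decide) (by decide)
  set s' := P.eval s with hs'
  have e : s'.arr = s.arr := rfl
  have e7 : s'.reg 7 = j := by simp [hs', hP, Prog.eval, h7]
  have e11 : s'.reg 11 = 0 := by simp [hs', hP, Prog.eval]
  have e12 : s'.reg 12 = 0 := by simp [hs', hP, Prog.eval]
  have e19 : s'.reg 19 = 1 := by simp [hs', hP, Prog.eval]
  refine (coupled_loop_iid (N := k) (fun q (v : Fin q → ZMod 2) t =>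
      t.reg 11 = q ∧ t.reg 12 = n * q ∧
      (0 < t.reg 19 ↔ ∀ c : Fin q, (c : ℕ) ≠ j → v c = 0 ∨
          ∀ i < n, s.arr 5 0 (n * c + i) = s.arr 6 c i) ∧
        (j < q → t.reg 22 = n * j)) h'.r2 ?_ ?_).mono fun _ _ _ _ h => h.2.2
  · exact ⟨e11, by simp [e12], by simp [e19], by simp⟩
  · rintro q hq v t ⟨t11, t12, t19, t22⟩ hk
    have ht := h'.of_keeps (by decide) (by decide) hk
    have t5 : t.arr 5 = s.arr 5 := hk.arr 5 (by decide)
    have t6 : t.arr 6 = s.arr 6 := hk.arr 6 (by decide)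
    refine (coupled_checkBlock (ht.tick 1) ((hk.reg 7 (by decide)).trans e7) t11 t12).mono ?_
    rintro w u - - ⟨u11, u12, u19, u22⟩
    refine ⟨u11, u12, ?_, ?_⟩
    · rw [Fin.forall_fin_succ', u19]
      simp only [Store.tick_reg, Store.tick_arr, t19, t5, t6]
      simp
    · intro hj
      rw [u22]
      split_ifs with hc
      · rw [hc]
      · exact t22 (by omega)

theorem forall_output {s : Store} (h : Context n m k σ A b s) {p : ℕ} (h22 : s.reg 22 = p) :
    ∀ t ∈ (exec η O .output s).support, (0 < s.reg 19 → ∀ i < n, t.arr 2 0 i = s.arr 5 0 (p + i)) ∧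
      (s.reg 19 = 0 → t.arr 2 = s.arr 2) := by
  intro t ht
  rw [Prog.output, exec] at ht
  beta_reduce at ht
  split_ifs at ht with h19
  · refine ⟨fun _ => ?_, fun h => absurd h h19.ne'⟩
    rw [exec] at ht
    beta_reduce at ht
    rw [exec_straight _ rfl, PMF.pure_bind] at ht
    have h' := (h.tick 1).of_eval (P := .const 13 0) rfl (by decide) (by decide)
    refine (forall_support_loop (fun q t => t.reg 13 = q ∧ t.reg 22 = p + q ∧
        ∀ i < q, t.arr 2 0 i = s.arr 5 0 (p + i)) h'.r0 ?_ ?_ t ht).2.2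
    · exact ⟨by simp [Prog.eval], by simp [Prog.eval, h22], by simp⟩
    · rintro q hq t ⟨t13, t22, t2⟩ hk u hu
      have ht := h'.of_keeps (by decide) (by decide) hk
      have t5 : t.arr 5 = s.arr 5 := hk.arr 5 (by decide)
      rw [eq_eval_of_mem_support rfl hu]
      refine ⟨by simp [Prog.copyBit, Prog.eval, t13, ht.r9],
        by simp [Prog.copyBit, Prog.eval, t22, ht.r9, add_assoc], ?_⟩
      rw [Nat.forall_lt_succ_right]
      constructor
      · intro i hi
        simpa [Prog.copyBit, Prog.eval, t13, ht.r8, Store.setCell_arr, hi.ne] using t2 i hi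
      · simp [Prog.copyBit, Prog.eval, t13, ht.r8, Store.setCell_arr, t22, t5]
  · refine ⟨fun h => absurd h h19, fun _ => ?_⟩
    rw [exec, PMF.mem_support_pure_iff] at ht
    rw [ht]
    rfl

end verification

/-! ### The law of a round -/

/-- A secret together with the rows of the matrix and the noise bits of its samples. -/
abbrev Block (m n : ℕ) : Type := (Fin n → ZMod 2) × (Fin m → (Fin n → ZMod 2) × ZMod 2)

/-- The law of a random block. -/
def blockLaw (η : ℝ) (σ n m : ℕ) : PMF (Block m n) :=
  (PMF.uniformOfFintype (Fin n → ZMod 2)).bind fun s => (iid (Fin m) (rowLaw η σ n)).map (Prod.mk s)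

/-- The program draws all secrets and then row after row across all blocks; the analysis wants
independent blocks. Both are the same family of independent samples, with the order of the indices
exchanged. -/
theorem iid_blockLaw (η : ℝ) (σ n m k : ℕ) :
    ((iid (Fin k) (iid (Fin n) (PMF.uniformOfFintype (ZMod 2)))).bind fun S =>
      (iid (Fin m) (iid (Fin k) (rowLaw η σ n))).map fun x c => (S c, fun r => x r c))
      = iid (Fin k) (blockLaw η σ n m) := by
  rw [blockLaw, ← iid_pair, uniform_pi_eq_iid, ← iid_swap (ι := Fin m) (κ := Fin k)]
  simp only [PMF.map_comp]
  rfl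

variable {m n k : ℕ}

/-- The matrix of the large instance, with the matrix `A` in block `j`. -/
def plantMat (A : Matrix (Fin m) (Fin n) (ZMod 2)) (j : Fin k) (y : Fin k → Block m n) :
    Matrix (Fin m) (Fin (k * n)) (ZMod 2) := fun r l =>
  if (finProdFinEquiv.symm l).1 = j then A r (finProdFinEquiv.symm l).2
    else ((y (finProdFinEquiv.symm l).1).2 r).1 (finProdFinEquiv.symm l).2

/-- The right hand side of the large instance, with the right hand side `b` for block `j`. -/
def plantVec (b : Fin m → ZMod 2) (j : Fin k) (y : Fin k → Block m n) : Fin m → ZMod 2 := fun r =>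
  b r + ∑ c, if c = j then 0 else ∑ i, ((y c).2 r).1 i * (y c).1 i + ((y c).2 r).2

/-- The answer `z` in block `c`. -/
def answer (z : Fin (k * n) → ZMod 2) (c : Fin k) : Fin n → ZMod 2 := fun i =>
  z (finProdFinEquiv (c, i))

/-- The new output of a round, if there is one. -/
def outcome (j : Fin k) (y : Fin k → Block m n) (z : Fin (k * n) → ZMod 2) (v : Fin k → ZMod 2) :
    Option (Fin n → ZMod 2) :=
  open Classical in
  if ∀ c, c ≠ j → v c = 0 ∨ answer z c = (y c).1 then some (answer z j) else none

/-- The law of the outcome of a round. -/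
def roundLaw [Nonempty (Fin k)] (η : ℝ) (σ : ℕ) (O : Solver m (k * n))
    (A : Matrix (Fin m) (Fin n) (ZMod 2)) (b : Fin m → ZMod 2) :
    PMF (Option (Fin n → ZMod 2)) :=
  (PMF.uniformOfFintype (Fin k)).bind fun j => (iid (Fin k) (blockLaw η σ n m)).bind fun y =>
  (O (plantMat A j y) (plantVec b j y)).bind fun z =>
  (iid (Fin k) (PMF.uniformOfFintype (ZMod 2))).map (outcome j y z)

/-- The enumeration `finProdFinEquiv` is the column layout of the program. -/
theorem encodeVec_answer (z : Fin (k * n) → ZMod 2) (c : Fin k) (i : Fin n) :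
    encodeVec z 0 (n * c + i) = (answer z c i).val := by
  have h : n * (c : ℕ) + i < k * n := by
    have := (finProdFinEquiv (c, i)).2
    rw [finProdFinEquiv_apply_val] at this
    dsimp only at this
    omega
  rw [encodeVec, dif_pos ⟨rfl, h⟩, answer]
  congr 2
  apply Fin.ext
  rw [finProdFinEquiv_apply_val]
  dsimp only
  omega

variable {η : ℝ} {σ : ℕ} {O : Solver m (k * n)}

/-- The outcome `none` means that the previous output stays in array `2`. -/
theorem coupled_query_check_output {A : ℕ → ℕ → ℕ} {b : ℕ → ℕ → ℕ} {s : Store}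
    (h : Context n m k σ A b s) {j : Fin k} (h7 : s.reg 7 = j) {y : Fin k → Block m n}
    {M : Matrix (Fin m) (Fin (k * n)) (ZMod 2)} {v : Fin m → ZMod 2}
    (h6 : ∀ (c : Fin k) (i : Fin n), s.arr 6 c i = if (c : ℕ) = j then 0 else ((y c).1 i).val)
    (hM : decodeMat m (k * n) (s.arr 3) = M) (hv : decodeVec m (s.arr 4) = v) :
    Coupled (exec η O (.seq .query (.seq .check .output)) s)
      ((O M v).bind fun z => (iid (Fin k) (PMF.uniformOfFintype (ZMod 2))).map (outcome j y z))
      (fun o t => decodeVec n (t.arr 2) = o.getD (decodeVec n (s.arr 2))) := by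
  refine coupled_seq (Φ := fun z t => t = (s.setArr 5 (encodeVec z)).tick (m * (k * n) + m + k * n))
    ?_ ?_
  · rw [exec]
    beta_reduce
    rw [hM, hv]
    exact Coupled.map_self fun _ => rfl
  · rintro z t rfl hk
    have ht := h.of_keeps (by decide) (by decide) hk
    have h5 : ((s.setArr 5 (encodeVec z)).tick (m * (k * n) + m + k * n)).arr 5 = encodeVec z := by
      simp [Store.setArr]
    have t6 := hk.arr 6 (by decide)
    have t2 := hk.arr 2 (by decide)
    have t7 := (hk.reg 7 (by decide)).trans h7
    generalize ((s.setArr 5 (encodeVec z)).tick (m * (k * n) + m + k * n)) = t at *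
    rw [exec]
    have hc := (coupled_check (η := η) (O := O) ht t7).mono (Ψ := fun w u =>
      ((0 < u.reg 19 ↔ ∀ c, c ≠ j → w c = 0 ∨ answer z c = (y c).1) ∧ u.reg 22 = n * j) ∧
        Keeps .check t u) ?_
    · refine ((hc.bind_det (Ψ := fun w u => decodeVec n (u.arr 2)
        = (outcome j y z w).getD (decodeVec n (s.arr 2))) ?_)).map_right fun _ _ h => h
      rintro w u ⟨⟨u19, u22⟩, hu⟩ x hx
      have hu' := ht.of_keeps (by decide) (by decide) hu
      obtain ⟨x1, x2⟩ := forall_output hu' u22 x hx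
      rw [hu.arr 5 (by decide), h5] at x1
      rw [hu.arr 2 (by decide), t2] at x2
      unfold outcome
      split_ifs with hcond
      · rw [Option.getD_some]
        ext i
        rw [decodeVec, x1 (u19.2 hcond) i i.2, encodeVec_answer]
        simp
      · rw [Option.getD_none, x2]
        by_contra h0
        exact hcond (u19.1 (Nat.pos_of_ne_zero h0))
    · rintro w u - hu ⟨hw, h22⟩
      refine ⟨⟨?_, h22 j.2⟩, keeps_of_mem_support _ _ u hu⟩
      rw [hw]
      refine forall_congr' fun c => ?_
      have hcj : (c : ℕ) ≠ j ↔ c ≠ j := by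
        rw [Ne, Fin.val_inj]
      rw [hcj]
      refine imp_congr_right fun hcj' => or_congr_right ?_
      rw [h5, t6, funext_iff, Fin.forall_iff]
      refine forall_congr' fun i => forall_congr' fun hi => ?_
      have e1 := encodeVec_answer z c ⟨i, hi⟩
      have e2 := h6 c ⟨i, hi⟩
      rw [if_neg (hcj.2 hcj')] at e2
      dsimp only at e1 e2
      rw [e1, e2]
      exact (ZMod.val_injective 2).eq_iff

theorem coupled_round [Nonempty (Fin k)] {A : Matrix (Fin m) (Fin n) (ZMod 2)} {b : Fin m → ZMod 2}
    {s : Store}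
    (h : Context n m k σ (encodeMat A) (encodeVec b) s) (hn : 0 < n) (hk : 0 < k) (hσ : σ ≤ n) :
    Coupled (exec η O .round s) (roundLaw η σ O A b)
      (fun o t => decodeVec n (t.arr 2) = o.getD (decodeVec n (s.arr 2)) ∧
        Context n m k σ (encodeMat A) (encodeVec b) t) := by
  refine Coupled.mono (Φ := fun o t => decodeVec n (t.arr 2) = o.getD (decodeVec n (s.arr 2))) ?_
    fun _ t _ ht hd => ⟨hd, h.of_keeps (by decide) (by decide) (keeps_of_mem_support _ _ t ht)⟩
  rw [Prog.round, roundLaw]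
  refine coupled_seq (Φ := fun (j : Fin k) t => t = (s.setReg 7 j).tick 1) ?_ ?_
  · rw [exec_rand hk h.r2]
    exact Coupled.map_self fun _ => rfl
  rintro j t rfl hk1
  have h1 := h.of_keeps (by decide) (by decide) hk1
  have e7 : ((s.setReg 7 j).tick 1).reg 7 = j := by simp
  have e2 := hk1.arr 2 (by decide)
  generalize (s.setReg 7 j).tick 1 = t at *
  rw [← iid_blockLaw, PMF.bind_bind]
  refine coupled_seq (coupled_secrets h1 e7) ?_
  rintro S u u6 hk2
  have h2 := h1.of_keeps (by decide) (by decide) hk2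
  have u7 := (hk2.reg 7 (by decide)).trans e7
  rw [← e2, ← hk2.arr 2 (by decide), PMF.bind_map]
  refine coupled_seq (coupled_rows h2 hn hσ u7 ?_ ?_) ?_
  · intro c hc i hi
    have := u6 ⟨c, hc⟩ ⟨i, hi⟩
    dsimp only at this
    rw [this]
    split_ifs
    · exact zero_le_one
    · exact Nat.le_of_lt_succ (ZMod.val_lt _)
  · intro hj i hi
    have := u6 j ⟨i, hi⟩
    simpa using this
  rintro x w ⟨w4, w3⟩ hk3
  have h3 := h2.of_keeps (by decide) (by decide) hk3
  rw [← hk3.arr 2 (by decide)]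
  refine coupled_query_check_output h3 ((hk3.reg 7 (by decide)).trans u7) ?_ ?_ ?_
  · rw [hk3.arr 6 (by decide)]
    exact u6
  · ext r l
    obtain ⟨⟨c, i⟩, rfl⟩ := finProdFinEquiv.surjective l
    have := w3 r c i
    simp only [decodeMat, Matrix.of_apply, plantMat, Equiv.symm_apply_apply,
      finProdFinEquiv_apply_val]
    rw [add_comm, this]
    by_cases hc : c = j
    · subst hc
      simp [encodeMat]
    · have hc' : (c : ℕ) ≠ j := fun h => hc (Fin.ext h)
      simp [hc, hc']
  · ext r
    rw [decodeVec, w4 r, plantVec]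
    congr 1
    · simp [encodeVec]
    · refine Finset.sum_congr rfl fun c _ => ?_
      by_cases hc : c = j
      · subst hc
        simp [u6]
      · have hc' : (c : ℕ) ≠ j := fun h => hc (Fin.ext h)
        simp [u6, hc, hc']

/-- The output after some number of rounds. -/
def outputLaw [Nonempty (Fin k)] (η : ℝ) (σ : ℕ) (O : Solver m (k * n))
    (A : Matrix (Fin m) (Fin n) (ZMod 2)) (b : Fin m → ZMod 2) (T : ℕ) : PMF (Fin n → ZMod 2) :=
  (fun μ : PMF (Fin n → ZMod 2) => μ.bind fun z => (roundLaw η σ O A b).map fun o => o.getD z)^[T]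
    (PMF.pure 0)

theorem coupled_loop_const {α : Type} {K : α → PMF α} {a₀ : α} (Φ : α → Store → Prop) {x N : ℕ}
    {P : Prog} {s : Store} (hN : s.reg x = N) (h0 : Φ a₀ (s.tick 1))
    (hs : ∀ a t, Φ a t → Keeps P s t → Coupled (exec η O P (t.tick 1)) (K a) Φ) :
    Coupled (exec η O (.loop x P) s) ((fun μ : PMF α => μ.bind K)^[N] (PMF.pure a₀)) Φ := by
  rw [← chain_const_eq_iterate]
  exact coupled_loop (X := fun _ => α) (fun _ => Φ) hN h0 fun _ _ a t h1 h2 => hs a t h1 h2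

theorem iterate_bind {α : Type} (K : α → PMF α) (N : ℕ) (μ : PMF α) :
    (fun μ : PMF α => μ.bind K)^[N] μ
      = μ.bind fun a => (fun μ : PMF α => μ.bind K)^[N] (PMF.pure a) := by
  induction N generalizing μ with
  | zero => simp
  | succ N ih =>
    simp only [Function.iterate_succ_apply, PMF.pure_bind]
    rw [ih (μ.bind K), PMF.bind_bind]
    congr 1
    ext1 a
    exact (ih (K a)).symm

/-- Nested loops act as one loop with the product of the counts. The program nests its loops because
the machine cannot multiply. -/
theorem iterate_iterate_bind {α : Type} (K : α → PMF α) (M N : ℕ) (μ : PMF α) :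
    (fun μ : PMF α => μ.bind fun a => (fun μ : PMF α => μ.bind K)^[M] (PMF.pure a))^[N] μ
      = (fun μ : PMF α => μ.bind K)^[M * N] μ := by
  rw [Function.iterate_mul]
  congr 1
  ext1 ν
  exact (iterate_bind K M ν).symm

theorem toSolver_eq [Nonempty (Fin k)] (hn : 0 < n) (hk : 0 < k) (hσ : σ ≤ n) (ε δ : ℝ)
    (A : Matrix (Fin m) (Fin n) (ZMod 2)) (b : Fin m → ZMod 2) :
    Prog.solver.toSolver η O n k σ ε δ A b
      = outputLaw η σ O A b (⌈1 / δ⌉₊ * ⌈1 / ε⌉₊ * 8) := by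
  let K : (Fin n → ZMod 2) → PMF (Fin n → ZMod 2) := fun z =>
    (roundLaw η σ O A b).map fun o => o.getD z
  have e : outputLaw η σ O A b (⌈1 / δ⌉₊ * ⌈1 / ε⌉₊ * 8)
      = (fun μ : PMF (Fin n → ZMod 2) => μ.bind fun a =>
        (fun μ : PMF (Fin n → ZMod 2) => μ.bind fun a =>
        (fun μ : PMF (Fin n → ZMod 2) => μ.bind K)^[⌈1 / δ⌉₊] (PMF.pure a))^[⌈1 / ε⌉₊]
          (PMF.pure a))^[8] (PMF.pure 0) := by
    simp only [iterate_iterate_bind]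
    rfl
  have key : Coupled (Prog.solver.run η O k σ ε δ A b)
      (outputLaw η σ O A b (⌈1 / δ⌉₊ * ⌈1 / ε⌉₊ * 8))
      (fun z t => decodeVec n (t.arr 2) = z ∧ t.reg 4 = ⌈1 / ε⌉₊ ∧ t.reg 5 = ⌈1 / δ⌉₊ ∧
        Context n m k σ (encodeMat A) (encodeVec b) t) := by
    rw [e, Prog.run, Prog.solver]
    refine coupled_straight_seq rfl ?_
    refine coupled_loop_const _ ?_ ?_ ?_
    · simp [Prog.eval]
    · refine ⟨?_, rfl, rfl, ?_⟩
      · ext i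
        simp [Prog.eval, initStore, decodeVec]
      · constructor <;> simp [Prog.eval, initStore]
    rintro z t ⟨tz, t4, t5, ht⟩ -
    refine coupled_loop_const _ t4 ⟨tz, t4, t5, ht.tick 2⟩ ?_
    rintro z t ⟨tz, t4, t5, ht⟩ -
    refine coupled_loop_const _ t5 ⟨tz, t4, t5, ht.tick 2⟩ ?_
    rintro z t ⟨tz, t4, t5, ht⟩ -
    refine ((coupled_round (ht.tick 1) hn hk hσ).mono (Ψ := fun o u =>
      (decodeVec n (u.arr 2) = o.getD (decodeVec n ((t.tick 1).arr 2)) ∧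
        Context n m k σ (encodeMat A) (encodeVec b) u) ∧ Keeps .round (t.tick 1) u)
      fun o u _ hu h => ⟨h, keeps_of_mem_support _ _ u hu⟩).map_right ?_
    rintro o u ⟨⟨h1, h2⟩, h3⟩
    refine ⟨?_, ?_, ?_, h2⟩
    · rw [h1, ← tz]
      rfl
    · rw [h3.reg 4 (by decide)]
      exact t4
    · rw [h3.reg 5 (by decide)]
      exact t5
  have := key.map_eq (f := id) (g := fun t => decodeVec n (t.arr 2)) fun z t h => h.1
  rw [PMF.map_id] at this
  exact this

/-! ### Number of steps -/

/-- The cost is a polynomial whose monomials are all at most `m * k * n`, the number of matrix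
entries; `200` generously bounds the sum of its coefficients. -/
theorem cost_round_le {m n k q : ℕ} (hm : 0 < m) (hn : 0 < n) (hk : 0 < k) {ρ : ℕ → ℕ}
    (h0 : ρ 0 = n) (h1 : ρ 1 = m) (h2 : ρ 2 = k) (hq : q ≤ 3 * (m * k * n)) :
    Prog.round.cost q ρ ≤ 200 * (m * k * n) := by
  have e1 : m * n * k = m * k * n := by ring
  have a1 : 1 ≤ m * k * n := Nat.mul_pos (Nat.mul_pos hm hk) hn
  have a2 : k ≤ m * k * n := by nlinarith [Nat.mul_pos hm hn]
  have a3 : k * n ≤ m * k * n := by nlinarith [Nat.mul_pos hk hn]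
  have a4 : n ≤ m * k * n := by nlinarith [Nat.mul_pos hm hk]
  have a5 : m ≤ m * k * n := by nlinarith [Nat.mul_pos hk hn]
  have a6 : m * k ≤ m * k * n := by nlinarith [Nat.mul_pos hm hk]
  simp only [Prog.round, Prog.secrets, Prog.secretBlock, Prog.secretBit, Prog.rows, Prog.row,
    Prog.rowBlock, Prog.entry, Prog.check, Prog.checkBlock, Prog.compareBit, Prog.output,
    Prog.copyBit, Prog.distinct, Prog.cost, h0, h1, h2]
  ring_nf
  ring_nf at *
  linarith

theorem nested_cost_le {P E D c : ℕ} (hP : 1 ≤ P) (hE : 1 ≤ E) (hD : 1 ≤ D)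
    (hc : c ≤ 200 * P) :
    3 + (1 + 8 * (1 + (1 + E * (1 + (1 + D * (1 + c)))))) ≤ 4000 * (P * E * D) := by
  have b0 : D * (1 + c) ≤ D * (201 * P) := Nat.mul_le_mul_left _ (by omega)
  have b1 : 1 ≤ P * E * D := Nat.mul_pos (Nat.mul_pos hP hE) hD
  have b2 : E ≤ P * E * D := by nlinarith [Nat.mul_pos hP hD]
  have b3 : E * (1 + (1 + D * (1 + c))) ≤ E * (2 + D * (201 * P)) :=
    Nat.mul_le_mul_left _ (by omega)
  have b4 : E * (2 + D * (201 * P)) = 2 * E + 201 * (P * E * D) := by ring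
  omega

theorem steps_le {m n k σ : ℕ} {ε δ η : ℝ} (hm : 0 < m) (hn : 0 < n) (hk : 0 < k)
    (hε : 0 < ε) (hδ : 0 < δ) (O : Solver m (k * n)) (A : Matrix (Fin m) (Fin n) (ZMod 2))
    (b : Fin m → ZMod 2) :
    ∀ s ∈ (Prog.solver.run η O k σ ε δ A b).support,
      (s.steps : ℝ) ≤ (4000 : ℕ) * m * ((n : ℝ) + k + 1 / δ + 1 / ε) ^ 4000 := by
  intro s hs
  rw [Prog.run, Prog.solver, exec] at hs
  beta_reduce at hs
  rw [exec_straight _ rfl, PMF.pure_bind] at hs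
  set u := Prog.eval (.seq (.const 6 8) (.seq (.const 9 1) (.const 10 2)))
    (initStore k σ ε δ A b) with hu
  have r0 : u.reg 0 = n := by simp [hu, Prog.eval, initStore]
  have r1 : u.reg 1 = m := by simp [hu, Prog.eval, initStore]
  have r2 : u.reg 2 = k := by simp [hu, Prog.eval, initStore]
  have r4 : u.reg 4 = ⌈1 / ε⌉₊ := by simp [hu, Prog.eval, initStore]
  have r5 : u.reg 5 = ⌈1 / δ⌉₊ := by simp [hu, Prog.eval, initStore]
  have r6 : u.reg 6 = 8 := by simp [hu, Prog.eval]
  have hsteps : u.steps = 3 := rfl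
  have h := steps_le_of_mem_support u.reg (.loop 6 (.loop 4 (.loop 5 .round))) (by decide) u
    (fun _ _ => rfl) s hs
  have hE : 1 ≤ ⌈1 / ε⌉₊ := Nat.one_le_ceil_iff.2 (by positivity)
  have hD : 1 ≤ ⌈1 / δ⌉₊ := Nat.one_le_ceil_iff.2 (by positivity)
  have hP : 1 ≤ m * k * n := Nat.mul_pos (Nat.mul_pos hm hk) hn
  have hc := cost_round_le (q := m * (k * n) + m + k * n) hm hn hk r0 r1 r2 (by
    have a3 : k * n ≤ m * (k * n) := Nat.le_mul_of_pos_left _ hm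
    have a5 : m ≤ m * (k * n) := Nat.le_mul_of_pos_right _ (Nat.mul_pos hk hn)
    rw [mul_assoc m k n]
    omega)
  simp only [Prog.cost, r4, r5, r6, hsteps] at h
  have hceilE : (⌈1 / ε⌉₊ : ℝ) ≤ 1 / ε + 1 := (Nat.ceil_lt_add_one (by positivity)).le
  have hceilD : (⌈1 / δ⌉₊ : ℝ) ≤ 1 / δ + 1 := (Nat.ceil_lt_add_one (by positivity)).le
  generalize ⌈1 / ε⌉₊ = E at *
  generalize ⌈1 / δ⌉₊ = D at *
  generalize Prog.round.cost (m * (k * n) + m + k * n) u.reg = c at *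
  have h1 : s.steps ≤ 4000 * (m * k * n * E * D) := h.trans (nested_cost_le hP hE hD hc)
  have hn' : (1 : ℝ) ≤ n := by exact_mod_cast hn
  have hk' : (1 : ℝ) ≤ k := by exact_mod_cast hk
  have hε' : 0 < 1 / ε := by positivity
  have hδ' : 0 < 1 / δ := by positivity
  set S : ℝ := (n : ℝ) + k + 1 / δ + 1 / ε with hS
  have hS1 : 1 ≤ S := by linarith
  calc (s.steps : ℝ) ≤ ((4000 * (m * k * n * E * D) : ℕ) : ℝ) := by exact_mod_cast h1
    _ = 4000 * m * (k * n * E * D) := by push_cast; ring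
    -- Each of the four factors is at most `S`; the `+ 1` from rounding up is absorbed since `1 ≤
    -- n`.
    _ ≤ 4000 * m * (S * S * S * S) := by
      gcongr <;> linarith
    _ = 4000 * m * S ^ 4 := by ring
    -- Degree `4` would do, but the same constant serves as factor and exponent; the increase is
    -- harmless as `1 ≤ S`.
    _ ≤ (4000 : ℕ) * m * S ^ 4000 := by
      push_cast
      gcongr
      norm_num

/-! ### The success probability in terms of blocks -/

theorem toReal_bind {α β : Type} [Fintype α] (μ : PMF α) (f : α → PMF β) (b : β) :
    ((μ.bind f) b).toReal = ∑ a, (μ a).toReal * (f a b).toReal := by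
  rw [PMF.bind_apply, tsum_fintype, ENNReal.toReal_sum]
  · simp only [ENNReal.toReal_mul]
  · intro a _
    exact ENNReal.mul_ne_top (PMF.apply_ne_top _ _) (PMF.apply_ne_top _ _)

theorem toReal_sum_eq_one {α : Type} [Fintype α] (μ : PMF α) : ∑ a, (μ a).toReal = 1 := by
  rw [← ENNReal.toReal_sum fun a _ => PMF.apply_ne_top _ _, ← tsum_fintype (L := .unconditional _),
    μ.tsum_coe, ENNReal.toReal_one]

namespace Block

variable {m n k : ℕ}

/-- The matrix of a block. -/
def mat (x : Block m n) : Matrix (Fin m) (Fin n) (ZMod 2) := Matrix.of fun r => (x.2 r).1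

/-- The right hand side of a block. -/
def vec (x : Block m n) : Fin m → ZMod 2 := fun r => ∑ i, (x.2 r).1 i * x.1 i + (x.2 r).2

/-- The concatenation of vectors. -/
def joinVec (v : Fin k → Fin n → ZMod 2) : Fin (k * n) → ZMod 2 := fun l =>
  v (finProdFinEquiv.symm l).1 (finProdFinEquiv.symm l).2

/-- Secrets and rows are concatenated, the noise is added up. -/
def join (x : Fin k → Block m n) : Block m (k * n) :=
  (joinVec fun c => (x c).1, fun r => (joinVec fun c => ((x c).2 r).1, ∑ c, ((x c).2 r).2))

end Block

open Block

theorem iid_joinVec {n k : ℕ} (μ : PMF (ZMod 2)) :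
    (iid (Fin k) (iid (Fin n) μ)).map joinVec = iid (Fin (k * n)) μ := by
  rw [← iid_reindex μ finProdFinEquiv, ← iid_curry, PMF.map_comp]
  rfl

theorem rowLaw_join {η : ℝ} (h0 : 0 ≤ η) (h1 : η ≤ 1 / 2) {σ n k : ℕ} (hk : 0 < k) :
    (iid (Fin k) (rowLaw η σ n)).map (fun v => (joinVec fun c => (v c).1, ∑ c, (v c).2))
      = rowLaw ((1 - (1 - 2 * η) ^ k) / 2) (k * σ) (k * n) := by
  have hk' : (k : ℝ) ≠ 0 := by exact_mod_cast hk.ne'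
  rw [rowLaw, rowLaw, ← iid_pair, PMF.map_bind, Nat.cast_mul, Nat.cast_mul,
    mul_div_mul_left _ _ hk', ← iid_joinVec, PMF.bind_map, ← ber_sum h0 h1]
  simp only [PMF.map_comp]
  rfl

theorem blockLaw_join {η : ℝ} (h0 : 0 ≤ η) (h1 : η ≤ 1 / 2) {σ n m k : ℕ} (hk : 0 < k) :
    (iid (Fin k) (blockLaw η σ n m)).map join
      = blockLaw ((1 - (1 - 2 * η) ^ k) / 2) (k * σ) (k * n) m := by
  rw [← iid_blockLaw, blockLaw, uniform_pi_eq_iid, ← iid_joinVec, PMF.map_bind, PMF.bind_map,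
    ← rowLaw_join h0 h1 hk, ← iid_map]
  simp only [PMF.map_comp]
  rfl

theorem approxSparse_eq_map_blockLaw (η : ℝ) (σ n m : ℕ) :
    approxSparse η σ n m = (blockLaw η σ n m).map fun x => (x.1, x.mat, x.vec) := by
  rw [approxSparse, blockLaw, PMF.map_bind]
  congr 1
  ext1 s
  rw [rowLaw, ← iid_pair, PMF.map_bind, PMF.map_bind]
  congr 1
  ext1 A
  rw [PMF.map_comp, PMF.map_comp, PMF.map]
  rfl

theorem successProb_eq_sum (η : ℝ) (σ n m : ℕ) (S : Solver m n) :
    successProb η σ n m S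
      = ∑ x : Block m n, (blockLaw η σ n m x).toReal * (S x.mat x.vec x.1).toReal := by
  classical
  rw [successProb, approxSparse_eq_map_blockLaw, PMF.bind_map, toReal_bind]
  refine Finset.sum_congr rfl fun x _ => ?_
  congr 2
  simp only [Function.comp]
  rw [PMF.map_apply, tsum_eq_single x.1]
  · simp
  · intro z hz
    simp [hz]

/-! ### A direct product theorem -/

section directProduct

open scoped Classical

variable {X Z : Type} {k : ℕ}

/-- The weight of a tuple of independent instances. -/
def prodWeight (p : X → ℝ) (x : Fin k → X) : ℝ := ∏ c, p (x c)

theorem prodWeight_nonneg {p : X → ℝ} (hp : ∀ x, 0 ≤ p x) (x : Fin k → X) : 0 ≤ prodWeight p x :=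
  Finset.prod_nonneg fun _ _ => hp _

/-- Stated without division, because `p (y j)` may vanish. -/
theorem prodWeight_update (p : X → ℝ) (y : Fin k → X) (j : Fin k) (x₀ : X) :
    p (y j) * prodWeight p (Function.update y j x₀) = p x₀ * prodWeight p y := by
  have h1 : prodWeight p (Function.update y j x₀)
      = ∏ c, Function.update (fun c => p (y c)) j (p x₀) c := by
    refine Finset.prod_congr rfl fun c _ => ?_
    by_cases hc : c = j
    · subst hc; simp
    · simp [hc]
  rw [h1, Finset.prod_update_of_mem (Finset.mem_univ j), prodWeight,
    ← Finset.mul_prod_erase _ _ (Finset.mem_univ j), Finset.sdiff_singleton_eq_erase]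
  ring

/-- Exchange a coordinate of a tuple with a separate element. -/
def exchange (j : Fin k) : X × (Fin k → X) ≃ X × (Fin k → X) where
  toFun a := (a.2 j, Function.update a.2 j a.1)
  invFun a := (a.2 j, Function.update a.2 j a.1)
  left_inv a := by simp
  right_inv a := by simp

/-- Natural number weights against a geometric discount. -/
theorem mul_half_pow_le {L : ℝ} (hL : 2 ≤ L) (w : ℕ) :
    (w : ℝ) * (1 / 2) ^ w ≤ L * (1 / 2) ^ w + L * Real.exp (-(L * Real.log 2)) := by
  have hlog : 1 / 2 ≤ Real.log 2 := by
    have := Real.log_two_gt_d9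
    linarith
  have hpow : ((1 : ℝ) / 2) ^ w = Real.exp (-(w * Real.log 2)) := by
    rw [Real.exp_neg, mul_comm, Real.exp_mul, Real.exp_log (by norm_num), Real.rpow_natCast]
    simp
  rcases le_total (w : ℝ) L with h | h
  · have h1 : (w : ℝ) * (1 / 2) ^ w ≤ L * (1 / 2) ^ w := by gcongr
    have h2 : 0 ≤ L * Real.exp (-(L * Real.log 2)) := by positivity
    linarith
  · have h0 : 0 ≤ L * (1 / 2 : ℝ) ^ w := by positivity
    suffices h3 : (w : ℝ) * (1 / 2) ^ w ≤ L * Real.exp (-(L * Real.log 2)) by linarith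
    rw [hpow]
    have h4 : (w : ℝ) ≤ L * Real.exp ((w - L) * Real.log 2) := by
      have h5 := Real.add_one_le_exp ((w - L) * Real.log 2)
      -- The right side equals `L` at `w = L` and has slope `L * Real.log 2`, which is at least `1`
      -- because `2 ≤ L` and `1 / 2 ≤ Real.log 2`.
      have h6 : (w : ℝ) ≤ L * ((w - L) * Real.log 2 + 1) := by
        nlinarith [mul_nonneg (sub_nonneg.2 h) (by nlinarith : (0 : ℝ) ≤ L * Real.log 2 - 1)]
      exact h6.trans (by gcongr)
    calc (w : ℝ) * Real.exp (-(w * Real.log 2))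
        ≤ L * Real.exp ((w - L) * Real.log 2) * Real.exp (-(w * Real.log 2)) := by gcongr
      _ = L * Real.exp (-(L * Real.log 2)) := by
        rw [mul_assoc, ← Real.exp_add]
        congr 2
        ring

variable (correct : (Fin k → X) → Z → Fin k → Prop) (q : (Fin k → X) → Z → ℝ)
  [Fintype Z]

/-- The number of wrong components of an answer. -/
def wrongs (x : Fin k → X) (z : Z) : ℕ := (Finset.univ.filter fun c => ¬ correct x z c).card

/-- The mean of the discount for wrong components. -/
def discount (x : Fin k → X) : ℝ := ∑ z, q x z * (1 / 2) ^ wrongs correct x z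

/-- The discounted probability, doubled, of a wrong answer in component `j`. -/
def wrongDiscount (j : Fin k) (x : Fin k → X) : ℝ :=
  ∑ z, q x z * ((if correct x z j then 0 else 2) * (1 / 2) ^ wrongs correct x z)

/-- Summing over `j` counts the wrong components, which produces `2 * w * 2^(-w)`. Few wrong
components cost at most a factor `2 * L`, many are suppressed by the discount. -/
theorem sum_wrongDiscount_le (hq : ∀ x z, 0 ≤ q x z) (hq1 : ∀ x, ∑ z, q x z = 1) {L : ℝ}
    (hL : 2 ≤ L) (x : Fin k → X) :
    ∑ j, wrongDiscount correct q j x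
      ≤ 2 * L * discount correct q x + 2 * L * Real.exp (-(L * Real.log 2)) := by
  have e : ∑ j, wrongDiscount correct q j x
      = ∑ z, q x z * (2 * (wrongs correct x z * (1 / 2) ^ wrongs correct x z)) := by
    simp only [wrongDiscount]
    rw [Finset.sum_comm]
    refine Finset.sum_congr rfl fun z _ => ?_
    rw [← Finset.mul_sum, ← Finset.sum_mul]
    congr 1
    have : ∑ c, (if correct x z c then (0 : ℝ) else 2) = 2 * wrongs correct x z := by
      rw [wrongs, Finset.sum_ite, Finset.sum_const_zero, Finset.sum_const, zero_add,
        nsmul_eq_mul, mul_comm]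
    rw [this]
    ring
  rw [e, discount, Finset.mul_sum]
  have e2 : 2 * L * Real.exp (-(L * Real.log 2))
      = ∑ z, q x z * (2 * L * Real.exp (-(L * Real.log 2))) := by
    rw [← Finset.sum_mul, hq1, one_mul]
  rw [e2, ← Finset.sum_add_distrib]
  refine Finset.sum_le_sum fun z _ => ?_
  have := mul_le_mul_of_nonneg_left (mul_half_pow_le hL (wrongs correct x z)) (hq x z)
  linarith

variable [Fintype X]

/-- The mean of `G` over tuples with `x₀` at position `j`. -/
def plant (p : X → ℝ) (G : (Fin k → X) → ℝ) (j : Fin k) (x₀ : X) : ℝ :=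
  ∑ y, prodWeight p y * G (Function.update y j x₀)

theorem sum_prodWeight_mul_prod (p f : X → ℝ) :
    ∑ x : Fin k → X, prodWeight p x * ∏ c, f (x c) = (∑ x, p x * f x) ^ k := by
  have := (Finset.prod_univ_sum (fun _ : Fin k => (Finset.univ : Finset X))
    (fun _ a => p a * f a)).symm
  rw [Fintype.piFinset_univ, Finset.prod_const, Finset.card_univ, Fintype.card_fin] at this
  rw [← this]
  simp only [prodWeight, Finset.prod_mul_distrib]

theorem sum_prodWeight {p : X → ℝ} (hp1 : ∑ x, p x = 1) :
    ∑ x : Fin k → X, prodWeight p x = 1 := by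
  have := sum_prodWeight_mul_prod (k := k) p (fun _ => 1)
  simpa [hp1] using this

/-- Exchanging the planted instance with the coordinate it replaces preserves the product law: a
random instance planted in a random tuple is again a random tuple. -/
theorem sum_mul_plant {p : X → ℝ} (hp1 : ∑ x, p x = 1) (G : (Fin k → X) → ℝ) (h : X → ℝ)
    (j : Fin k) :
    ∑ x₀, p x₀ * (h x₀ * plant p G j x₀) = ∑ x, prodWeight p x * (G x * h (x j)) := by
  have h1 : ∑ x₀, p x₀ * (h x₀ * plant p G j x₀)
      = ∑ a : X × (Fin k → X), p a.1 * prodWeight p a.2 *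
        (G (Function.update a.2 j a.1) * h a.1) := by
    rw [Fintype.sum_prod_type]
    refine Finset.sum_congr rfl fun x₀ _ => ?_
    rw [plant, Finset.mul_sum, Finset.mul_sum]
    exact Finset.sum_congr rfl fun y _ => by ring
  rw [h1, ← (exchange j).sum_comp]
  have h2 : ∀ a : X × (Fin k → X), p (exchange j a).1 * prodWeight p (exchange j a).2 *
      (G (Function.update (exchange j a).2 j (exchange j a).1) * h (exchange j a).1)
      = p a.1 * (prodWeight p a.2 * (G a.2 * h (a.2 j))) := by
    intro a
    simp only [exchange, Equiv.coe_fn_mk, prodWeight_update, Function.update_idem,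
      Function.update_eq_self]
    ring
  simp only [h2]
  rw [Fintype.sum_prod_type]
  simp only [← Finset.mul_sum]
  rw [← Finset.sum_mul, hp1, one_mul]

theorem sum_mul_avg_plant {p : X → ℝ} (hp1 : ∑ x, p x = 1) (G : Fin k → (Fin k → X) → ℝ)
    (h : X → ℝ) :
    ∑ x₀, p x₀ * (h x₀ * (1 / k * ∑ j, plant p (G j) j x₀))
      = 1 / k * ∑ x, prodWeight p x * ∑ j, G j x * h (x j) := by
  have e : ∀ x₀, p x₀ * (h x₀ * (1 / k * ∑ j, plant p (G j) j x₀))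
      = 1 / k * ∑ j, p x₀ * (h x₀ * plant p (G j) j x₀) := by
    intro x₀
    simp only [Finset.mul_sum]
    exact Finset.sum_congr rfl fun j _ => by ring
  simp only [e]
  rw [← Finset.mul_sum, Finset.sum_comm]
  simp only [sum_mul_plant hp1]
  rw [Finset.sum_comm]
  simp only [Finset.mul_sum]

/-- A set of instances whose tuples carry little weight has small probability. -/
theorem prob_le_of_discounted {p : X → ℝ} (hp : ∀ x, 0 ≤ p x) (hp1 : ∑ x, p x = 1) (hk : 0 < k)
    {u : (Fin k → X) → ℝ} (hu1 : ∀ x, u x ≤ 1) (hu0 : ∀ x, 0 ≤ u x) (H : X → Prop)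
    {μ : ℝ} (hμ : μ = ∑ x, prodWeight p x * u x)
    (hH : ∀ x, H x → 1 / k * ∑ j, plant p u j x ≤ μ / 4) {l h : ℝ} (hl : 0 < l)
    (hμl : 4 * Real.exp (-l) < μ) (hh : h = ∑ x, if H x then p x else 0) :
    h * k ≤ 12 * l := by
  by_contra hcon
  push Not at hcon
  have hk' : (0 : ℝ) < k := by exact_mod_cast hk
  have hpos : 0 < h := by
    by_contra h0
    push Not at h0
    nlinarith
  have hle : h ≤ 1 := by
    rw [hh, ← hp1]
    refine Finset.sum_le_sum fun x _ => ?_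
    split_ifs
    · exact le_rfl
    · exact hp x
  let g : X → ℝ := fun x => if H x then 1 else 0
  have hg : ∑ x, p x * g x = h := by
    rw [hh]
    exact Finset.sum_congr rfl fun x _ => by simp [g]
  -- the discounted number of instances in `H`, from above
  have up : 1 / k * ∑ x, prodWeight p x * ∑ j, u x * g (x j) ≤ h * (μ / 4) := by
    rw [← sum_mul_avg_plant hp1 (fun _ => u) g, ← hg, Finset.sum_mul]
    refine Finset.sum_le_sum fun x _ => ?_
    rw [mul_assoc]
    refine mul_le_mul_of_nonneg_left ?_ (hp x)
    by_cases hx : H x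
    · simpa [g, hx] using hH x hx
    · simp [g, hx]
  -- and from below
  set a : ℝ := h * k / 2 with ha
  -- Let `y` be the number of components in `H`. If `a ≤ y`, dropping the exponential term suffices;
  -- if `y ≤ a`, the subtracted term `2^(a - y)` is at least `1`, hence at least `u x`, and the left
  -- side is not positive. The product has the merit that its mean is computable.
  have low : ∀ x : Fin k → X, a * (u x - Real.exp (a * Real.log 2) *
      ∏ c, (if H (x c) then (1 / 2 : ℝ) else 1)) ≤ ∑ j, u x * g (x j) := by
    intro x
    set y := (Finset.univ.filter fun c => H (x c)).card with hy
    have e1 : ∑ j, u x * g (x j) = u x * y := by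
      rw [← Finset.mul_sum]
      simp [g, hy]
    have e2 : ∏ c, (if H (x c) then (1 / 2 : ℝ) else 1) = (1 / 2) ^ y := by
      rw [Finset.prod_ite, Finset.prod_const, Finset.prod_const_one, mul_one]
    have e3 : ((1 : ℝ) / 2) ^ y = Real.exp (-(y * Real.log 2)) := by
      rw [Real.exp_neg, mul_comm, Real.exp_mul, Real.exp_log (by norm_num), Real.rpow_natCast]
      simp
    rw [e1, e2, e3, ← Real.exp_add]
    have ha0 : 0 < a := by positivity
    rcases le_total a y with hay | hay
    · have : 0 < Real.exp (a * Real.log 2 + -(y * Real.log 2)) := Real.exp_pos _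
      nlinarith [hu0 x]
    · have h1 : 1 ≤ Real.exp (a * Real.log 2 + -(y * Real.log 2)) := by
        apply Real.one_le_exp
        have := Real.log_pos (one_lt_two)
        nlinarith
      have h2 : 0 ≤ u x * y := mul_nonneg (hu0 x) (Nat.cast_nonneg _)
      nlinarith [hu1 x]
  have mean : ∑ x : Fin k → X, prodWeight p x * ∏ c, (if H (x c) then (1 / 2 : ℝ) else 1)
      = (1 - h / 2) ^ k := by
    rw [sum_prodWeight_mul_prod p (fun x => if H x then (1 / 2 : ℝ) else 1)]
    congr 1
    have : ∀ x, p x * (if H x then (1 / 2 : ℝ) else 1) = p x - p x * g x / 2 := by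
      intro x
      by_cases hx : H x <;> simp [g, hx]
      ring
    simp only [this]
    rw [Finset.sum_sub_distrib, hp1, ← Finset.sum_div, hg]
  have down : a * (μ - Real.exp (a * Real.log 2) * (1 - h / 2) ^ k)
      ≤ ∑ x, prodWeight p x * ∑ j, u x * g (x j) := by
    rw [← mean, hμ, Finset.mul_sum, ← Finset.sum_sub_distrib, Finset.mul_sum]
    refine Finset.sum_le_sum fun x _ => ?_
    have := mul_le_mul_of_nonneg_left (low x) (prodWeight_nonneg hp x)
    linarith
  have up' : ∑ x, prodWeight p x * ∑ j, u x * g (x j) ≤ a * (μ / 2) := by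
    rw [div_mul_eq_mul_div, one_mul, div_le_iff₀ hk'] at up
    rw [ha]
    linarith
  have hexp : (1 - h / 2) ^ k ≤ Real.exp (-a) := by
    have h1 := Real.add_one_le_exp (-(h / 2))
    calc (1 - h / 2) ^ k ≤ Real.exp (-(h / 2)) ^ k := by
          apply pow_le_pow_left₀ <;> linarith
      _ = Real.exp (-a) := by
          rw [← Real.exp_nat_mul]
          congr 1
          rw [ha]
          ring
  have ha0 : 0 < a := by positivity
  have h5 : μ / 2 ≤ Real.exp (a * Real.log 2) * (1 - h / 2) ^ k := by
    have := down.trans up'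
    have := le_of_mul_le_mul_left this ha0
    linarith
  -- Here `6 * l < a` and `1 - Real.log 2 > 1 / 6`.
  have h6 : Real.exp (a * Real.log 2) * (1 - h / 2) ^ k ≤ Real.exp (-l) := by
    calc _ ≤ Real.exp (a * Real.log 2) * Real.exp (-a) := by gcongr
      _ = Real.exp (a * Real.log 2 + -a) := (Real.exp_add _ _).symm
      _ ≤ Real.exp (-l) := by
        apply Real.exp_le_exp.2
        have := Real.log_two_lt_d9
        have : 6 * l < a := by rw [ha]; linarith
        nlinarith
  have := Real.exp_pos (-l)
  linarith

/-- The function `err` is kept abstract: all that matters is the bound that repeated rounds achieve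
on instances with a sufficient discounted weight. -/
theorem direct_product {p : X → ℝ} (hp : ∀ x, 0 ≤ p x) (hp1 : ∑ x, p x = 1)
    (hq : ∀ x z, 0 ≤ q x z) (hq1 : ∀ x, ∑ z, q x z = 1) (hk : 0 < k) {ε δ : ℝ}
    (hε : 0 < ε) (hδ : 0 < δ) (h : 192 / δ * Real.log (8 / ε) < k)
    (hs : ε ≤ ∑ x, prodWeight p x * ∑ z, if ∀ c, correct x z c then q x z else 0)
    {err : X → ℝ} (he1 : ∀ x, err x ≤ 1)
    (herr : ∀ x, ε / 4 ≤ 1 / k * ∑ j, plant p (discount correct q) j x →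
      err x ≤ δ / 2 + (1 / k * ∑ j, plant p (wrongDiscount correct q j) j x) /
        (1 / k * ∑ j, plant p (discount correct q) j x)) :
    ∑ x, p x * err x ≤ δ := by
  have hk' : (0 : ℝ) < k := by exact_mod_cast hk
  set u := discount correct q with hu
  have hu0 : ∀ x, 0 ≤ u x := fun x =>
    Finset.sum_nonneg fun z _ => mul_nonneg (hq x z) (by positivity)
  have hu1 : ∀ x, u x ≤ 1 := by
    intro x
    refine le_of_le_of_eq ?_ (hq1 x)
    refine Finset.sum_le_sum fun z _ => mul_le_of_le_one_right (hq x z) ?_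
    exact pow_le_one₀ (by norm_num) (by norm_num)
  set μ := ∑ x, prodWeight p x * u x with hμ
  have hεμ : ε ≤ μ := by
    refine hs.trans (Finset.sum_le_sum fun x _ =>
      mul_le_mul_of_nonneg_left ?_ (prodWeight_nonneg hp x))
    rw [hu, discount]
    refine Finset.sum_le_sum fun z _ => ?_
    split_ifs with hc
    · simp [wrongs, hc]
    · exact mul_nonneg (hq x z) (by positivity)
  have hμ1 : μ ≤ 1 := by
    rw [← sum_prodWeight (k := k) hp1]
    exact Finset.sum_le_sum fun x _ =>
      mul_le_of_le_one_right (prodWeight_nonneg hp x) (hu1 x)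
  have hμ0 : 0 < μ := hε.trans_le hεμ
  set l := Real.log (8 / ε) with hl
  have hexp : Real.exp (-l) = ε / 8 := by
    rw [hl, Real.exp_neg, Real.exp_log (by positivity), inv_div]
  have hl2 : 2 ≤ l := by
    rw [hl, Real.le_log_iff_exp_le (by positivity)]
    have h1 : Real.exp 2 = Real.exp 1 * Real.exp 1 := by rw [← Real.exp_add]; norm_num
    have h2 := Real.exp_one_lt_d9
    have h3 := Real.exp_pos 1
    have h4 : (8 : ℝ) ≤ 8 / ε := by
      rw [le_div_iff₀ hε]
      linarith
    nlinarith
  have hkl : 192 * l < δ * k := by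
    rw [div_mul_eq_mul_div, div_lt_iff₀ hδ] at h
    linarith
  set U : X → ℝ := fun x => 1 / k * ∑ j, plant p u j x with hU
  set W : X → ℝ := fun x => 1 / k * ∑ j, plant p (wrongDiscount correct q j) j x with hW
  have hW0 : ∀ x, 0 ≤ W x := by
    intro x
    refine mul_nonneg (by positivity) (Finset.sum_nonneg fun j _ => Finset.sum_nonneg fun y _ =>
      mul_nonneg (prodWeight_nonneg hp y) (Finset.sum_nonneg fun z _ => mul_nonneg (hq _ z) ?_))
    split_ifs <;> positivity
  -- bad instances are rare
  have hbad : (∑ x, if U x ≤ μ / 4 then p x else 0) ≤ δ / 4 := by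
    -- This bounds the probability by `12 * l / k`, which is below `δ / 16` by the lower bound on
    -- `k`.
    have := prob_le_of_discounted hp hp1 hk hu1 hu0 (fun x => U x ≤ μ / 4) hμ (fun x hx => hx)
      (l := l) (by linarith) (by rw [hexp]; linarith) rfl
    by_contra hc
    push Not at hc
    nlinarith
  -- wrong answers are rare
  set L := δ / 64 * k with hLdef
  have hL3 : 3 * l ≤ L := by rw [hLdef]; linarith
  -- Since `3 * Real.log 2 > 1`, the tail is at most `exp (-l) = ε / 8`, hence at most `μ`.
  have hLexp : Real.exp (-(L * Real.log 2)) ≤ μ := by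
    have : Real.exp (-(L * Real.log 2)) ≤ Real.exp (-l) := by
      apply Real.exp_le_exp.2
      have := Real.log_two_gt_d9
      nlinarith
    rw [hexp] at this
    linarith
  have hEW : ∑ x, p x * W x ≤ δ / 16 * μ := by
    have e := sum_mul_avg_plant hp1 (fun j => wrongDiscount correct q j) (fun _ => 1)
    simp only [one_mul, mul_one] at e
    have e' : ∑ x, p x * W x = 1 / k * ∑ x, prodWeight p x * ∑ j, wrongDiscount correct q j x := e
    rw [e', div_mul_eq_mul_div, one_mul, div_le_iff₀ hk']
    calc ∑ x, prodWeight p x * ∑ j, wrongDiscount correct q j x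
        ≤ ∑ x, prodWeight p x * (2 * L * u x + 2 * L * μ) := by
          refine Finset.sum_le_sum fun x _ => mul_le_mul_of_nonneg_left ?_ (prodWeight_nonneg hp x)
          have := sum_wrongDiscount_le correct q hq hq1 (L := L) (by linarith) x
          have h2 : 2 * L * Real.exp (-(L * Real.log 2)) ≤ 2 * L * μ := by
            have : 0 ≤ 2 * L := by linarith
            gcongr
          linarith
      _ = 2 * L * μ + 2 * L * μ := by
          simp only [mul_add, Finset.sum_add_distrib, ← Finset.sum_mul]
          rw [sum_prodWeight hp1, hμ, Finset.mul_sum]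
          congr 1
          · exact Finset.sum_congr rfl fun x _ => by ring
          · ring
      _ = δ / 16 * μ * k := by rw [hLdef]; ring
  -- Bad instances are charged with error `1`. Otherwise `U x > μ / 4 ≥ ε / 4`, so `herr` applies,
  -- and `W x / U x ≤ 4 / μ * W x`.
  have key : ∀ x, p x * err x
      ≤ (if U x ≤ μ / 4 then p x else 0) + p x * (δ / 2) + 4 / μ * (p x * W x) := by
    intro x
    have h3 : 0 ≤ 4 / μ * (p x * W x) := mul_nonneg (by positivity) (mul_nonneg (hp x) (hW0 x))
    have h4 : 0 ≤ p x * (δ / 2) := mul_nonneg (hp x) (by positivity)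
    split_ifs with hx
    · have := mul_le_of_le_one_right (hp x) (he1 x)
      linarith
    · push Not at hx
      have hUpos : 0 < U x := by linarith
      have h5 : err x ≤ δ / 2 + W x / U x := herr x (by
        change ε / 4 ≤ U x
        linarith)
      have h6 : W x / U x ≤ 4 / μ * W x := by
        rw [div_le_iff₀ hUpos]
        have h7 : 1 ≤ 4 / μ * U x := by
          rw [div_mul_eq_mul_div, le_div_iff₀ hμ0]
          linarith
        nlinarith [hW0 x]
      have := mul_le_mul_of_nonneg_left (h5.trans (add_le_add_right h6 _)) (hp x)
      linarith
  calc ∑ x, p x * err x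
      ≤ ∑ x, ((if U x ≤ μ / 4 then p x else 0) + p x * (δ / 2) + 4 / μ * (p x * W x)) :=
        Finset.sum_le_sum fun x _ => key x
    _ = (∑ x, if U x ≤ μ / 4 then p x else 0) + δ / 2 + 4 / μ * ∑ x, p x * W x := by
        rw [Finset.sum_add_distrib, Finset.sum_add_distrib, ← Finset.sum_mul, hp1, one_mul,
          ← Finset.mul_sum]
    _ ≤ δ / 4 + δ / 2 + 4 / μ * (δ / 16 * μ) := by gcongr
    _ = δ := by field_simp; norm_num

end directProduct

/-! ### Correctness of the solver -/

open scoped Classical in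
theorem toReal_map {α β : Type} [Fintype α] (μ : PMF α) (f : α → β) (b : β) :
    (μ.map f b).toReal = ∑ a, if b = f a then (μ a).toReal else 0 := by
  rw [PMF.map, toReal_bind]
  refine Finset.sum_congr rfl fun a _ => ?_
  simp only [Function.comp, PMF.pure_apply]
  split_ifs <;> simp

section correctness

open Block

variable {m n k : ℕ}

theorem joinVec_apply (v : Fin k → Fin n → ZMod 2) (c : Fin k) (i : Fin n) :
    joinVec v (finProdFinEquiv (c, i)) = v c i := by
  simp [joinVec]

theorem join_vec (x : Fin k → Block m n) (r : Fin m) : (join x).vec r = ∑ c, (x c).vec r := by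
  simp only [vec, join, Finset.sum_add_distrib]
  congr 1
  rw [← finProdFinEquiv.sum_comp, Fintype.sum_prod_type]
  simp only [joinVec_apply]

/-- Without knowing the secret of `x₀`, the program produces exactly the large instance belonging to
the tuple with `x₀` at position `j`. -/
theorem plantMat_eq (x₀ : Block m n) (j : Fin k) (y : Fin k → Block m n) :
    plantMat x₀.mat j y = (join (Function.update y j x₀)).mat := by
  ext r l
  simp only [plantMat, mat, join, Matrix.of_apply, joinVec]
  split_ifs with h
  · rw [h, Function.update_self]
  · rw [Function.update_of_ne h]

theorem plantVec_eq (x₀ : Block m n) (j : Fin k) (y : Fin k → Block m n) :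
    plantVec x₀.vec j y = (join (Function.update y j x₀)).vec := by
  ext r
  rw [join_vec, plantVec, ← Finset.add_sum_erase _ _ (Finset.mem_univ j), if_pos rfl, zero_add,
    ← Finset.add_sum_erase _ (fun c => (Function.update y j x₀ c).vec r) (Finset.mem_univ j),
    Function.update_self]
  congr 1
  refine Finset.sum_congr rfl fun c hc => ?_
  have hc' := Finset.ne_of_mem_erase hc
  rw [if_neg hc', Function.update_of_ne hc']
  rfl

/-- The acceptance test never inspects block `j`. -/
theorem outcome_update (x₀ : Block m n) (j : Fin k) (y : Fin k → Block m n)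
    (z : Fin (k * n) → ZMod 2) : outcome j y z = outcome j (Function.update y j x₀) z := by
  ext1 v
  unfold outcome
  congr 1
  apply propext
  refine forall_congr' fun c => ?_
  refine imp_congr_right fun hc => ?_
  rw [Function.update_of_ne hc]

/-- The answer is correct in a component. -/
def correctAt (x : Fin k → Block m n) (z : Fin (k * n) → ZMod 2) (c : Fin k) : Prop :=
  answer z c = (x c).1

open scoped Classical in
-- The probability of acceptance factors over the blocks: `1/2` for each wrong block other than `j`,
-- and `1` otherwise. If block `j` is wrong as well, its missing factor `1/2` is compensated by the
-- `2`.
theorem toReal_coins (j : Fin k) (x : Fin k → Block m n) (z : Fin (k * n) → ZMod 2) :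
    (∑ v, if ∀ c, c ≠ j → v c = 0 ∨ answer z c = (x c).1 then
      (iid (Fin k) (PMF.uniformOfFintype (ZMod 2)) v).toReal else 0)
      = (if correctAt x z j then 1 else 2) * (1 / 2) ^ wrongs correctAt x z := by
  have e1 : ∀ v : Fin k → ZMod 2, (if ∀ c, c ≠ j → v c = 0 ∨ answer z c = (x c).1 then
      (iid (Fin k) (PMF.uniformOfFintype (ZMod 2)) v).toReal else 0)
      = ∏ c, if c ≠ j → v c = 0 ∨ answer z c = (x c).1 then (1 / 2 : ℝ) else 0 := by
    intro v
    split_ifs with h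
    · rw [iid_apply, ENNReal.toReal_prod]
      refine Finset.prod_congr rfl fun c _ => ?_
      rw [if_pos (h c)]
      simp
    · push Not at h
      obtain ⟨c, hc⟩ := h
      symm
      refine Finset.prod_eq_zero (Finset.mem_univ c) (if_neg ?_)
      rintro h
      rcases h hc.1 with h | h
      · exact hc.2.1 h
      · exact hc.2.2 h
  simp only [e1]
  have := (Finset.prod_univ_sum (fun _ : Fin k => (Finset.univ : Finset (ZMod 2)))
    (fun c a => if c ≠ j → a = 0 ∨ answer z c = (x c).1 then (1 / 2 : ℝ) else 0)).symm
  rw [Fintype.piFinset_univ] at this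
  rw [this]
  have e2 : ∀ c, (∑ a : ZMod 2, if c ≠ j → a = 0 ∨ answer z c = (x c).1 then (1 / 2 : ℝ) else 0)
      = if c = j ∨ correctAt x z c then 1 else 1 / 2 := by
    intro c
    have h' : (Finset.univ : Finset (ZMod 2)) = {0, 1} := by decide
    rw [h', Finset.sum_pair (by decide)]
    by_cases hc : c = j
    · simp [hc]
      norm_num
    · by_cases hc' : answer z c = (x c).1
      · simp [hc', correctAt]
        norm_num
      · simp [hc, hc', correctAt]
  simp only [e2]
  have e3 : ((1 : ℝ) / 2) ^ wrongs correctAt x z = ∏ c, if correctAt x z c then (1 : ℝ) else 1 / 2 := by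
    rw [Finset.prod_ite, Finset.prod_const_one, one_mul, Finset.prod_const, wrongs]
  rw [e3, ← Finset.mul_prod_erase _ _ (Finset.mem_univ j),
    ← Finset.mul_prod_erase Finset.univ (fun c => if correctAt x z c then (1 : ℝ) else 1 / 2)
      (Finset.mem_univ j), if_pos (Or.inl rfl), one_mul]
  have e4 : ∏ c ∈ Finset.univ.erase j, (if c = j ∨ correctAt x z c then (1 : ℝ) else 1 / 2)
      = ∏ c ∈ Finset.univ.erase j, if correctAt x z c then (1 : ℝ) else 1 / 2 := by
    refine Finset.prod_congr rfl fun c hc => ?_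
    simp [Finset.ne_of_mem_erase hc]
  rw [e4]
  split_ifs <;> ring

open scoped Classical in
-- The value is `2^(-w)` or `0`; the form of a difference makes it linear in the terms of `discount`
-- and `wrongDiscount`.
theorem toReal_outcome_some (j : Fin k) (x : Fin k → Block m n) (z : Fin (k * n) → ZMod 2) :
    ((iid (Fin k) (PMF.uniformOfFintype (ZMod 2))).map (outcome j x z) (some (x j).1)).toReal
      = (1 / 2) ^ wrongs correctAt x z
        - (if correctAt x z j then 0 else 2) * (1 / 2) ^ wrongs correctAt x z / 2 := by
  rw [toReal_map]
  by_cases hj : correctAt x z j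
  · have := toReal_coins j x z
    rw [if_pos hj] at this ⊢
    rw [zero_mul, zero_div, sub_zero, ← one_mul ((1 / 2 : ℝ) ^ wrongs correctAt x z), ← this]
    refine Finset.sum_congr rfl fun v _ => ?_
    rw [correctAt] at hj
    unfold outcome
    by_cases hv : ∀ c, c ≠ j → v c = 0 ∨ answer z c = (x c).1
    · rw [if_pos hv, if_pos hv, if_pos (by rw [hj])]
    · rw [if_neg hv, if_neg hv, if_neg (by simp)]
  · rw [if_neg hj, Finset.sum_eq_zero]
    · ring
    · intro v _
      rw [correctAt] at hj
      rw [if_neg]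
      unfold outcome
      split_ifs
      · intro h
        exact hj (Option.some.inj h).symm
      · simp

open scoped Classical in
theorem toReal_outcome_none (j : Fin k) (x : Fin k → Block m n) (z : Fin (k * n) → ZMod 2) :
    ((iid (Fin k) (PMF.uniformOfFintype (ZMod 2))).map (outcome j x z) none).toReal
      = 1 - ((1 / 2) ^ wrongs correctAt x z
        + (if correctAt x z j then 0 else 2) * (1 / 2) ^ wrongs correctAt x z / 2) := by
  have h1 := toReal_coins j x z
  have h2 := toReal_sum_eq_one (iid (Fin k) (PMF.uniformOfFintype (ZMod 2)))
  have h3 : ((iid (Fin k) (PMF.uniformOfFintype (ZMod 2))).map (outcome j x z) none).toReal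
      = 1 - (if correctAt x z j then 1 else 2) * (1 / 2) ^ wrongs correctAt x z := by
    rw [toReal_map, ← h1, ← h2, ← Finset.sum_sub_distrib]
    refine Finset.sum_congr rfl fun v _ => ?_
    unfold outcome
    by_cases hv : ∀ c, c ≠ j → v c = 0 ∨ answer z c = (x c).1
    · rw [if_pos hv, if_pos hv, if_neg (by simp), sub_self]
    · rw [if_neg hv, if_neg hv, if_pos rfl, sub_zero]
  rw [h3]
  split_ifs <;> ring

variable {η : ℝ} {σ : ℕ}

theorem prodWeight_blockLaw (x : Fin k → Block m n) :
    prodWeight (fun x => (blockLaw η σ n m x).toReal) x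
      = (iid (Fin k) (blockLaw η σ n m) x).toReal := by
  rw [iid_apply, ENNReal.toReal_prod]
  rfl

/-- The law of the answer of the oracle on the large instance. -/
def answerWeight (O : Solver m (k * n)) (x : Fin k → Block m n) (z : Fin (k * n) → ZMod 2) : ℝ :=
  (O (join x).mat (join x).vec z).toReal

variable {O : Solver m (k * n)}

/-- The outcome `o` may depend on `x₀`, so `G` is only required to give its probability on tuples
with `x₀` planted at `j`. -/
theorem toReal_roundLaw [Nonempty (Fin k)] (x₀ : Block m n)
    (o : Option (Fin n → ZMod 2)) (G : Fin k → (Fin k → Block m n) → ℝ)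
    (hG : ∀ j y, G j (Function.update y j x₀)
      = ∑ z, answerWeight O (Function.update y j x₀) z *
        ((iid (Fin k) (PMF.uniformOfFintype (ZMod 2))).map
          (outcome j (Function.update y j x₀) z) o).toReal) :
    (roundLaw η σ O x₀.mat x₀.vec o).toReal
      = 1 / k * ∑ j, plant (fun x => (blockLaw η σ n m x).toReal) (G j) j x₀ := by
  rw [roundLaw, toReal_bind, Finset.mul_sum]
  refine Finset.sum_congr rfl fun j _ => ?_
  rw [toReal_bind, plant]
  congr 1
  · simp
  · refine Finset.sum_congr rfl fun y _ => ?_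
    rw [prodWeight_blockLaw, toReal_bind, hG, plantMat_eq, plantVec_eq]
    congr 1
    refine Finset.sum_congr rfl fun z _ => ?_
    rw [outcome_update x₀ j y z]
    rfl

theorem sum_answerWeight (O : Solver m (k * n)) (x : Fin k → Block m n) :
    ∑ z, answerWeight O x z = 1 :=
  toReal_sum_eq_one _

theorem plant_sub {X : Type} [Fintype X] (p : X → ℝ) (F G : (Fin k → X) → ℝ) (j : Fin k) (x₀ : X) :
    plant p (fun x => F x - G x) j x₀ = plant p F j x₀ - plant p G j x₀ := by
  simp only [plant, mul_sub, Finset.sum_sub_distrib]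

theorem plant_div {X : Type} [Fintype X] (p : X → ℝ) (G : (Fin k → X) → ℝ) (a : ℝ) (j : Fin k)
    (x₀ : X) : plant p (fun x => G x / a) j x₀ = plant p G j x₀ / a := by
  simp only [plant, mul_div_assoc', Finset.sum_div]

theorem plant_one {X : Type} [Fintype X] {p : X → ℝ} (hp1 : ∑ x, p x = 1) (j : Fin k)
    (x₀ : X) : plant p (fun _ => 1) j x₀ = 1 := by
  simp only [plant, mul_one, sum_prodWeight hp1]

theorem toReal_roundLaw_some [Nonempty (Fin k)] (x₀ : Block m n) :
    (roundLaw η σ O x₀.mat x₀.vec (some x₀.1)).toReal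
      = 1 / k * ∑ j, plant (fun x => (blockLaw η σ n m x).toReal)
          (discount correctAt (answerWeight O)) j x₀
        - (1 / k * ∑ j, plant (fun x => (blockLaw η σ n m x).toReal)
          (wrongDiscount correctAt (answerWeight O) j) j x₀) / 2 := by
  rw [toReal_roundLaw x₀ _ fun j x => discount correctAt (answerWeight O) x
    - wrongDiscount correctAt (answerWeight O) j x / 2]
  · simp only [plant_sub, plant_div, Finset.sum_sub_distrib, ← Finset.sum_div]
    ring
  · intro j y
    have := fun z => toReal_outcome_some j (Function.update y j x₀) z
    rw [Function.update_self] at this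
    simp only [this, discount, wrongDiscount]
    rw [Finset.sum_div, ← Finset.sum_sub_distrib]
    exact Finset.sum_congr rfl fun z _ => by ring

theorem toReal_roundLaw_none [Nonempty (Fin k)] (hk : 0 < k) (x₀ : Block m n) :
    (roundLaw η σ O x₀.mat x₀.vec none).toReal
      = 1 - 1 / k * ∑ j, plant (fun x => (blockLaw η σ n m x).toReal)
          (discount correctAt (answerWeight O)) j x₀
        - (1 / k * ∑ j, plant (fun x => (blockLaw η σ n m x).toReal)
          (wrongDiscount correctAt (answerWeight O) j) j x₀) / 2 := by
  have hk' : (k : ℝ) ≠ 0 := by exact_mod_cast hk.ne'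
  rw [toReal_roundLaw x₀ _ fun j x => 1 - discount correctAt (answerWeight O) x
    - wrongDiscount correctAt (answerWeight O) j x / 2]
  · simp only [plant_sub, plant_div, Finset.sum_sub_distrib, ← Finset.sum_div,
      plant_one (toReal_sum_eq_one (blockLaw η σ n m))]
    simp only [Finset.sum_const, Finset.card_univ, Fintype.card_fin, nsmul_eq_mul, mul_one]
    field_simp
  · intro j y
    classical
    have h1 := fun z => toReal_outcome_none j (Function.update y j x₀) z
    have h2 := sum_answerWeight O (Function.update y j x₀)
    simp only [h1, discount, wrongDiscount]
    generalize Function.update y j x₀ = x at *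
    have h3 : ∀ z, answerWeight O x z * (1 - ((1 / 2) ^ wrongs correctAt x z
        + (if correctAt x z j then 0 else 2) * (1 / 2) ^ wrongs correctAt x z / 2))
        = answerWeight O x z - answerWeight O x z * (1 / 2) ^ wrongs correctAt x z
          - answerWeight O x z *
            ((if correctAt x z j then 0 else 2) * (1 / 2) ^ wrongs correctAt x z) / 2 := by
      intro z
      ring
    simp only [h3]
    rw [Finset.sum_sub_distrib, Finset.sum_sub_distrib, h2, Finset.sum_div]

/-! ### The error after many rounds. -/

theorem toReal_map_getD {α : Type} [Fintype α] (μ : PMF (Option α)) (a s : α) [DecidableEq α] :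
    (μ.map (fun o => o.getD a) s).toReal
      = (μ (some s)).toReal + (μ none).toReal * if a = s then 1 else 0 := by
  rw [toReal_map, Fintype.sum_option, add_comm]
  congr 1
  · rw [Finset.sum_eq_single s]
    · simp
    · intro b _ hb
      rw [if_neg]
      simpa using hb.symm
    · simp
  · by_cases h : a = s
    · simp [h]
    · have : ¬ s = a := fun h' => h h'.symm
      simp [h, this]

/-- Either the last round outputs `s`, or it is rejected and the previous output was `s`. -/
theorem toReal_outputLaw_succ [Nonempty (Fin k)] (A : Matrix (Fin m) (Fin n) (ZMod 2))
    (b : Fin m → ZMod 2) (T : ℕ) (s : Fin n → ZMod 2) :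
    (outputLaw η σ O A b (T + 1) s).toReal = (roundLaw η σ O A b (some s)).toReal
      + (roundLaw η σ O A b none).toReal * (outputLaw η σ O A b T s).toReal := by
  classical
  rw [outputLaw, Function.iterate_succ_apply', ← outputLaw, toReal_bind]
  simp only [toReal_map_getD, mul_add, Finset.sum_add_distrib]
  rw [← Finset.sum_mul, toReal_sum_eq_one, one_mul]
  congr 1
  simp [mul_comm]

/-- The recursion has the fixed point `r / (1 - a)`, the probability of a right answer given
acceptance, and the deviation from it contracts by `a` in each step. -/
theorem one_sub_le_of_recursion {f : ℕ → ℝ} {r a : ℝ} (h0 : 0 ≤ f 0)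
    (hf : ∀ t, f (t + 1) = r + a * f t) (ha : 0 ≤ a) (ha1 : a < 1) (hra : r + a ≤ 1)
    (T : ℕ) :
    1 - f T ≤ a ^ T + (1 - a - r) / (1 - a) := by
  have hr : 1 - a ≠ 0 := by linarith
  have key : 1 - f T - (1 - a - r) / (1 - a) = a ^ T * (1 - f 0 - (1 - a - r) / (1 - a)) := by
    induction T with
    | zero => simp
    | succ T ih =>
      rw [pow_succ', mul_assoc, ← ih, hf]
      field_simp
      ring
  have h1 : 0 ≤ (1 - a - r) / (1 - a) := div_nonneg (by linarith) (by linarith)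
  have h2 : a ^ T * (1 - f 0 - (1 - a - r) / (1 - a)) ≤ a ^ T :=
    mul_le_of_le_one_right (pow_nonneg ha T) (by linarith)
  linarith

theorem error_le [Nonempty (Fin k)] (hk : 0 < k) {ε δ : ℝ} (hε : 0 < ε) (hδ : 0 < δ)
    (x₀ : Block m n)
    (hU : ε / 4 ≤ 1 / k * ∑ j, plant (fun x => (blockLaw η σ n m x).toReal)
          (discount correctAt (answerWeight O)) j x₀) :
    1 - (outputLaw η σ O x₀.mat x₀.vec (⌈1 / δ⌉₊ * ⌈1 / ε⌉₊ * 8) x₀.1).toReal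
      ≤ δ / 2 + (1 / k * ∑ j, plant (fun x => (blockLaw η σ n m x).toReal)
          (wrongDiscount correctAt (answerWeight O) j) j x₀) /
        (1 / k * ∑ j, plant (fun x => (blockLaw η σ n m x).toReal)
          (discount correctAt (answerWeight O)) j x₀) := by
  have hr := toReal_roundLaw_some (η := η) (σ := σ) (O := O) x₀
  have ha := toReal_roundLaw_none (η := η) (σ := σ) (O := O) hk x₀
  have hW : 0 ≤ 1 / (k : ℝ) * ∑ j, plant (fun x => (blockLaw η σ n m x).toReal)
      (wrongDiscount correctAt (answerWeight O) j) j x₀ := by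
    refine mul_nonneg (by positivity) (Finset.sum_nonneg fun j _ => Finset.sum_nonneg fun y _ =>
      mul_nonneg (prodWeight_nonneg (fun _ => ENNReal.toReal_nonneg) y)
        (Finset.sum_nonneg fun z _ => mul_nonneg ENNReal.toReal_nonneg ?_))
    split_ifs <;> positivity
  set U := 1 / (k : ℝ) * ∑ j, plant (fun x => (blockLaw η σ n m x).toReal)
          (discount correctAt (answerWeight O)) j x₀
  set W := 1 / (k : ℝ) * ∑ j, plant (fun x => (blockLaw η σ n m x).toReal)
      (wrongDiscount correctAt (answerWeight O) j) j x₀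
  have ha0 : 0 ≤ (roundLaw η σ O x₀.mat x₀.vec none).toReal := ENNReal.toReal_nonneg
  have h := one_sub_le_of_recursion (f := fun T => (outputLaw η σ O x₀.mat x₀.vec T x₀.1).toReal)
    ENNReal.toReal_nonneg (fun T => toReal_outputLaw_succ x₀.mat x₀.vec T x₀.1) ha0
    (by rw [ha]; linarith) (by rw [ha, hr]; linarith) (⌈1 / δ⌉₊ * ⌈1 / ε⌉₊ * 8)
  refine h.trans (add_le_add ?_ ?_)
  · have h1 : (roundLaw η σ O x₀.mat x₀.vec none).toReal ≤ Real.exp (-(ε / 4)) := by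
      have := Real.add_one_le_exp (-(ε / 4))
      rw [ha]
      linarith
    have h2 : 1 / δ ≤ (⌈1 / δ⌉₊ : ℝ) := Nat.le_ceil _
    have h3 : 1 / ε ≤ (⌈1 / ε⌉₊ : ℝ) := Nat.le_ceil _
    -- The `8` is chosen for this: `8 * (ε / 4) = 2 * ε`.
    have h4 : 2 / δ ≤ ((⌈1 / δ⌉₊ * ⌈1 / ε⌉₊ * 8 : ℕ) : ℝ) * (ε / 4) := by
      push_cast
      calc 2 / δ = 1 / δ * (1 / ε) * 8 * (ε / 4) := by field_simp; norm_num
        _ ≤ _ := by gcongr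
    calc _ ≤ Real.exp (-(ε / 4)) ^ (⌈1 / δ⌉₊ * ⌈1 / ε⌉₊ * 8) := pow_le_pow_left₀ ha0 h1 _
      _ = Real.exp (-(((⌈1 / δ⌉₊ * ⌈1 / ε⌉₊ * 8 : ℕ) : ℝ) * (ε / 4))) := by
        rw [← Real.exp_nat_mul]
        congr 1
        ring
      _ ≤ Real.exp (-(2 / δ)) := Real.exp_le_exp.2 (neg_le_neg h4)
      _ ≤ δ / 2 := by
        rw [Real.exp_neg, inv_le_comm₀ (Real.exp_pos _) (by positivity), inv_div]
        have := Real.add_one_le_exp (2 / δ)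
        linarith
  · have hUpos : 0 < U := by linarith
    rw [ha, hr]
    have e1 : 1 - (1 - U - W / 2) - (U - W / 2) = W := by ring
    rw [e1]
    -- The denominator, the acceptance probability `U + W / 2`, is at least `U`.
    apply div_le_div_of_nonneg_left hW hUpos
    linarith

theorem solver_success [Nonempty (Fin k)] (hn : 0 < n) (hk : 0 < k) (hσ : σ ≤ n) {ε δ : ℝ}
    (hε : 0 < ε) (hδ : 0 < δ) (h0 : 0 ≤ η) (h1 : η ≤ 1 / 2)
    (h : 192 / δ * Real.log (8 / ε) < k)
    (hO : ε ≤ successProb ((1 - (1 - 2 * η) ^ k) / 2) (k * σ) (k * n) m O) :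
    1 - δ ≤ successProb η σ n m (Prog.solver.toSolver η O n k σ ε δ) := by
  classical
  have hp1 := toReal_sum_eq_one (blockLaw η σ n m)
  have hs : ε ≤ ∑ x : Fin k → Block m n, prodWeight (fun x => (blockLaw η σ n m x).toReal) x *
      ∑ z, if ∀ c, correctAt x z c then answerWeight O x z else 0 := by
    refine hO.trans (le_of_eq ?_)
    -- A large random instance is the join of a tuple of blocks, and its secret is found exactly if
    -- every block of the answer is correct.
    rw [successProb_eq_sum, ← blockLaw_join h0 h1 hk]
    simp only [toReal_map, Finset.sum_mul, ite_mul, zero_mul]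
    rw [Finset.sum_comm]
    refine Finset.sum_congr rfl fun x _ => ?_
    rw [Finset.sum_ite_eq' Finset.univ (join x), if_pos (Finset.mem_univ _), prodWeight_blockLaw]
    congr 1
    rw [Finset.sum_eq_single (join x).1]
    · rw [if_pos]
      · rfl
      · intro c
        ext i
        exact joinVec_apply (fun c => (x c).1) c i
    · intro z _ hz
      rw [if_neg]
      intro hc
      apply hz
      ext l
      obtain ⟨⟨c, i⟩, rfl⟩ := finProdFinEquiv.surjective l
      exact (congrFun (hc c) i).trans (joinVec_apply (fun c => (x c).1) c i).symm
    · simp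
  have key := direct_product correctAt (answerWeight O) (p := fun x => (blockLaw η σ n m x).toReal)
    (fun _ => ENNReal.toReal_nonneg) hp1 (fun _ _ => ENNReal.toReal_nonneg) (sum_answerWeight O) hk
    hε hδ h hs
    (err := fun x => 1 - (outputLaw η σ O x.mat x.vec (⌈1 / δ⌉₊ * ⌈1 / ε⌉₊ * 8) x.1).toReal)
    (fun x => sub_le_self _ ENNReal.toReal_nonneg) (fun x hx => error_le hk hε hδ x hx)
  simp only [mul_sub, mul_one, Finset.sum_sub_distrib] at key
  rw [hp1] at key
  rw [successProb_eq_sum]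
  simp only [toSolver_eq hn hk hσ]
  linarith

end correctness

end

end LPN

theorem mainTheorem4 :
    ∃ (R : LPN.Prog) (C : ℕ), ∀ (m n k σ : ℕ) (ε δ η : ℝ),
      0 < m → 0 < n → 0 < k → 0 < σ → σ ≤ n →
      48 * ((n : ℝ) ^ 3 / (σ : ℝ) ^ 2) ≤ m →
      0 < ε → 6 * (1 / (2 : ℝ) ^ (2 * n - 1)) < δ → 0 < η → η < 1 / 8 →
      192 / δ * Real.log (8 / ε) < k → (k : ℝ) < (2 : ℝ) ^ (2 * n - 2) * ε →
      ∀ O : LPN.Solver m (k * n),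
        (∀ (A : Matrix (Fin m) (Fin n) (ZMod 2)) (b : Fin m → ZMod 2),
          ∀ s ∈ (R.run η O k σ ε δ A b).support,
            (s.steps : ℝ) ≤ C * m * ((n : ℝ) + k + 1 / δ + 1 / ε) ^ C) ∧
        (ε ≤ LPN.successProb ((1 - (1 - 2 * η) ^ k) / 2) (k * σ) (k * n) m O →
          1 - δ ≤ LPN.successProb η σ n m (R.toSolver η O n k σ ε δ)) := by
  refine ⟨LPN.Prog.solver, 4000, ?_⟩
  intro m n k σ ε δ η hm hn hk _ hσn _ hε hδ hη hη' hlog _ O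
  have hδ0 : 0 < δ := lt_trans (by positivity) hδ
  have : Nonempty (Fin k) := ⟨⟨0, hk⟩⟩
  exact ⟨LPN.steps_le hm hn hk hε hδ0 O,
    LPN.solver_success hn hk hσn hε hδ0 hη.le (by linarith) hlog⟩
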